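/- Let $k_n=2^n$ and consider the dyadic system $X_0=0$, $\dot X_n=k_{n-1}X_{n-1}^2-k_nX_nX_{n+1}$ $(n\ge 1)$. A positive solution is a family of continuously differentiable functions on $[0,\infty)$ with non-negative values satisfying all these equations; it has finite energy if $\sum_n X_n(t)^2<\infty$ for all $t\ge 0$. Put $\beta=2^{-1/3}$. **Theorem.** There is exactly one real sequence $(d_k)_{k\ge -1}$ with $d_{-1}=-1$ and $$\sum_{i=-1}^{k+1}d_id_{k-i}\,(4-\beta^{2k+2i})=2d_k\beta^{2k}\qquad(k\ge -1);$$ it satisfies $d_k\ge 0$ for $k\ge 0$, and the radius of convergence $R$ of $\sum_{k\ge 0}d_kx^k$ lies in $(4/5,1)$. The function $h(x)=-\sum_{k=-1}^{\infty}d_kx^k=\frac1x-\sum_{k\ge 0}d_kx^k$ on $(0,R)$ extends to a strictly decreasing bijection $h:(0,R]\to[0,\infty)$. Let $\gamma=h(\beta^2R)$. 1. For every $t_0<0$ and every integer $n_0\ge 0$ there is exactly one positive finite-energy solution of the self-similar form $X_n(t)=\frac{a_n}{t-t_0}$ with $a_1=\dots=a_{n_0}=0$ and $a_{n_0+1}\ne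 0$. It solves the system on all of $(t_0,\infty)$, its coefficients are $a_n=2^{-n}h(\beta^{2(n-n_0)}R)$ for $n>n_0$, and $$\lim_{n\to\infty}\frac{a_n}{k_n^{-1/3}}=C_{n_0}:=\frac{\beta^{2n_0}}{R}.$$ 2. For every $t_0<0$ and $n_0\ge 0$, a real sequence $(a_n)_{n\ge 0}$ is the coefficient sequence of a positive self-similar solution $X_n(t)=\frac{a_n}{t-t_0}$ (of finite energy or not) with $a_1=\dots=a_{n_0}=0$, $a_{n_0+1}\neq 0$ if and only if $$a_0=\dots=a_{n_0}=0,\qquad a_{n_0+1}>0,\qquad a_{n+1}=2^{-n}+\frac{a_{n-1}^2}{2a_n}\quad(n\ge n_0+1).\tag{$*$}$$ 3. For every $n_0\geq 0$, $\gamma$ is the unique real number such that every sequence $(a_n)$ satisfying $(*)$ is square summable if and only if $\tilde a_1:=2^{n_0+1}a_{n_0+1}=\gamma$. 4. Let $n_0\ge 0$ and let $(a_n)$ satisfy $(*)$. If $(a_n)$ is square summable, then $a_n=2^{-n}h(\beta^{2(n-n_0)}R)$ for all $n>n_0$, and $a_n\sim C_{n_0}\beta^n=C_{n_0}2^{-n/3}$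 as $n\to\infty$. Otherwise the odd-indexed or the even-indexed coefficients diverge to $+\infty$ faster than every exponential (for one $p\in\{0,1\}$, $a_{2k+p}/M^k\to+\infty$ for every $M>0$), and the power series $\sum_n a_nz^n$ has radius of convergence $0$. -/

import Mathlib

open Set Filter Topology Asymptotics

/-- The wave numbers `k_n = 2^n` of the dyadic model. -/
def waveNumber (n : ℕ) : ℝ := 2 ^ n

/-- `X` is a componentwise solution, on the time set `I`, of the unforced inviscid dyadic model
`X_0 = 0`, `X_n' = k_{n-1} X_{n-1}^2 - k_n X_n X_{n+1}` for `n ≥ 1`: all components are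
continuously differentiable on `I` (one-sided derivatives at end points that belong to `I`), and
all the equations hold on `I`. -/
structure IsComponentwiseSolutionOn (I : Set ℝ) (X : ℕ → ℝ → ℝ) : Prop where
  zero : ∀ t ∈ I, X 0 t = 0
  contDiffOn : ∀ n, ContDiffOn ℝ 1 (X n) I
  equation : ∀ n, 1 ≤ n → ∀ t ∈ I,
    HasDerivWithinAt (X n)
      (waveNumber (n - 1) * X (n - 1) t ^ 2 - waveNumber n * X n t * X (n + 1) t) I t

/-- A positive componentwise solution on `[0, ∞)`: every component is non-negative for every
`t ≥ 0`. -/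
def IsPositiveSolution (X : ℕ → ℝ → ℝ) : Prop :=
  IsComponentwiseSolutionOn (Ici 0) X ∧ ∀ t : ℝ, 0 ≤ t → ∀ n, 0 ≤ X n t

/-- The space `H` of square summable sequences. -/
def SquareSummable (u : ℕ → ℝ) : Prop := Summable fun n => u n ^ 2

/-- Finite energy: `X(t) ∈ H` for all `t ≥ 0`. -/
def HasFiniteEnergy (X : ℕ → ℝ → ℝ) : Prop :=
  ∀ t : ℝ, 0 ≤ t → SquareSummable fun n => X n t

/-- The self-similar family `X_n(t) = a_n / (t - t₀)`. -/
noncomputable def selfSimilar (t₀ : ℝ) (a : ℕ → ℝ) : ℕ → ℝ → ℝ :=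
  fun n t => a n / (t - t₀)

/-- `a_1 = … = a_{n₀} = 0` and `a_{n₀+1} ≠ 0`. -/
def StartsAfter (n₀ : ℕ) (a : ℕ → ℝ) : Prop :=
  (∀ n, 1 ≤ n → n ≤ n₀ → a n = 0) ∧ a (n₀ + 1) ≠ 0

/-- The recurrence of the coefficients of positive self-similar solutions:
`a_0 = … = a_{n₀} = 0`, `a_{n₀+1} > 0` and `a_{n+1} = 2^{-n} + a_{n-1}^2 / (2 a_n)` for
`n ≥ n₀ + 1`. -/
structure IsCoefficientSequence (n₀ : ℕ) (a : ℕ → ℝ) : Prop where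
  eq_zero : ∀ n, n ≤ n₀ → a n = 0
  pos : 0 < a (n₀ + 1)
  recurrence : ∀ n, n₀ + 1 ≤ n → a (n + 1) = (2 ^ n)⁻¹ + a (n - 1) ^ 2 / (2 * a n)

/-- The rescaled coefficients `ã_n = 2^{n+n₀} a_{n+n₀}`. -/
def rescaled (n₀ : ℕ) (a : ℕ → ℝ) (n : ℕ) : ℝ := 2 ^ (n + n₀) * a (n + n₀)

/-- `β = 2^{-1/3}`. -/
noncomputable def beta : ℝ := (2 : ℝ) ^ (-(1 / 3) : ℝ)

/-- The relations for `(d_k)_{k ≥ -1}`: `d_{-1} = -1` and, for all `k ≥ -1`,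
`∑_{i=-1}^{k+1} d_i d_{k-i} (4 - β^{2k+2i}) = 2 d_k β^{2k}`.
The values at indices below `-1` carry no meaning and are set to `0`. -/
structure IsSeriesCoefficients (d : ℤ → ℝ) : Prop where
  eq_zero : ∀ k, k < -1 → d k = 0
  neg_one : d (-1) = -1
  relation : ∀ k, -1 ≤ k →
    ∑ i ∈ Finset.Icc (-1) (k + 1), d i * d (k - i) * (4 - beta ^ (2 * k + 2 * i))
      = 2 * d k * beta ^ (2 * k)

/-- The radius of convergence of the real power series `∑ c_n x^n`. -/
noncomputable def convergenceRadius (c : ℕ → ℝ) : ENNReal :=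
  (FormalMultilinearSeries.ofScalars ℝ c).radius

/-- One of the two subsequences (of odd or of even indices) of `a` diverges to `+∞` faster than
any exponential. -/
def DivergesSuperExponentially (a : ℕ → ℝ) : Prop :=
  ∃ p : ℕ, (p = 0 ∨ p = 1) ∧
    ∀ M : ℝ, 0 < M → Tendsto (fun k : ℕ => a (2 * k + p) / M ^ k) atTop atTop

/-! Put q = β² and g(x) = x h(x) = 1 - ∑ e_m x^m with e_m = d_{m-1}. The relations for d say exactly
that g(x)² = g(qx)(g(q²x) - 2q²x), that is, h(qx)(h(q²x) - 2) = 4h(x)². Inserting X_n = a_n/(t - t₀)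
in the system leaves an algebraic recurrence, which for b_n = 2^{n+n₀} a_{n+n₀} reads b_{n+2} = 2 +
4b_n²/b_{n+1} with b_0 = 0. Hence s_n = h(q^n R) solves it as soon as h(R) = 0.

To find such an R, note that the e_m are non-negative and satisfy e_m ≤ c (e*e)_m for large m, for
every c > 1/2. This quadratic bound lets the series be continued past any point where its sum is
still below 1 (`exists_gt_sum_le_one`), so at R, the largest point with sum at most 1, the sum
equals 1 and g(R) = 0. Beyond R the functional equation would make a square negative, so R is also
the radius of convergence. At R it gives g(q²R) = 2q²R, from which the numerical bounds on R follow.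

Since g(q^n R) → 1, s_n grows like q^{-n}/R, and 2^{-n}s_n is square summable because 2q > 1. Any
other b is compared with s. As b_2 = 2 always, only b_1 distinguishes the two; after a few steps b_n
lies alternately above and below s_n, and along the indices where it lies above, b_n/s_n - 1 at
least grows geometrically (`tendsto_ratio`). Then b_{n+2} ≥ 4b_n²/s_{n+1} forces super-exponential
growth. So exactly one initial value gives finite energy. -/

/-! ### The base `q = β²` -/

/-- `q = β² = 2^{-2/3}`. -/
noncomputable def betaSq : ℝ := beta ^ 2

theorem beta_pos : 0 < beta := Real.rpow_pos_of_pos two_pos _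

theorem beta_pow_three : beta ^ 3 = 2⁻¹ := by
  rw [beta, ← Real.rpow_natCast, ← Real.rpow_mul two_pos.le]
  norm_num [Real.rpow_neg_one]

theorem betaSq_pos : 0 < betaSq := pow_pos beta_pos 2

theorem betaSq_pow_three : betaSq ^ 3 = 1 / 4 := by
  rw [betaSq, ← pow_mul, mul_comm, pow_mul, beta_pow_three]; norm_num

theorem lt_betaSq : 0.629 < betaSq :=
  lt_of_pow_lt_pow_left₀ 3 betaSq_pos.le (by rw [betaSq_pow_three]; norm_num)

theorem betaSq_lt : betaSq < 0.63 :=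
  lt_of_pow_lt_pow_left₀ 3 (by norm_num) (by rw [betaSq_pow_three]; norm_num)

theorem betaSq_lt_one : betaSq < 1 := betaSq_lt.trans (by norm_num)

theorem lt_betaSq_sq : 0.3956 < betaSq ^ 2 := by nlinarith [lt_betaSq]

theorem betaSq_sq_lt : betaSq ^ 2 < 0.3969 := by nlinarith [betaSq_lt, betaSq_pos]

theorem betaSq_pow_le {m n : ℕ} (h : n ≤ m) : betaSq ^ m ≤ betaSq ^ n :=
  pow_le_pow_of_le_one betaSq_pos.le betaSq_lt_one.le h

/-! ### The shifted coefficients -/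

/-- The shifted coefficients `e_m = d_{m-1}` for `m ≥ 1`, and `e_0 = 0`. -/
noncomputable def shiftedCoeff : ℕ → ℝ
  | 0 => 0
  | 1 => 2 * betaSq ^ 2 / (2 - betaSq - betaSq ^ 2)
  | n + 2 =>
    (∑ i : Fin (n + 1), shiftedCoeff (i + 1) * shiftedCoeff (n + 1 - i) *
        (1 - betaSq ^ ((i + 1) + 2 * (n + 1 - i : ℕ)))
      - 2 * betaSq ^ (n + 3) * shiftedCoeff (n + 1)) / (2 - betaSq ^ (n + 2) - betaSq ^ (2 * (n + 2)))
  decreasing_by all_goals omega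

theorem shiftedCoeff_zero : shiftedCoeff 0 = 0 := by rw [shiftedCoeff]

theorem shiftedCoeff_one : shiftedCoeff 1 * (2 - betaSq - betaSq ^ 2) = 2 * betaSq ^ 2 := by
  rw [shiftedCoeff, div_mul_cancel₀]
  nlinarith [betaSq_sq_lt, betaSq_lt]

theorem shiftedCoeff_denom_pos {m : ℕ} (hm : 1 ≤ m) :
    0 < 2 - betaSq ^ m - betaSq ^ (2 * m) := by
  have h1 : betaSq ^ m ≤ betaSq ^ 1 := betaSq_pow_le hm
  have h2 : betaSq ^ (2 * m) ≤ betaSq ^ 2 := betaSq_pow_le (by omega)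
  linarith [betaSq_lt, betaSq_sq_lt]

/-- The convention e_0 = 0 kills the end pairs (0, m) and (m, 0), so the full convolution involves
only e_1, …, e_{m-1}. -/
theorem shiftedCoeff_rec {m : ℕ} (hm : 2 ≤ m) :
    shiftedCoeff m * (2 - betaSq ^ m - betaSq ^ (2 * m)) =
      ∑ p ∈ Finset.HasAntidiagonal.antidiagonal m, shiftedCoeff p.1 * shiftedCoeff p.2 * (1 - betaSq ^ (p.1 + 2 * p.2))
        - 2 * betaSq ^ (m + 1) * shiftedCoeff (m - 1) := by
  obtain ⟨n, rfl⟩ := Nat.exists_eq_add_of_le' hm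
  rw [shiftedCoeff, div_mul_cancel₀ _ (shiftedCoeff_denom_pos (by omega)).ne']
  congr 1
  rw [Finset.Nat.sum_antidiagonal_eq_sum_range_succ_mk, Finset.sum_range_succ,
    Finset.sum_range_succ', Fin.sum_univ_eq_sum_range (fun i => shiftedCoeff (i + 1) * shiftedCoeff (n + 1 - i) *
        (1 - betaSq ^ ((i + 1) + 2 * (n + 1 - i : ℕ))))]
  simp only [Nat.sub_self, shiftedCoeff_zero, mul_zero, zero_mul, add_zero]
  refine Finset.sum_congr rfl fun i _ => ?_
  rw [show n + 2 - (i + 1) = n + 1 - i by omega]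

theorem lt_shiftedCoeff_one : 0.81 < shiftedCoeff 1 := by
  nlinarith [shiftedCoeff_one, lt_betaSq, lt_betaSq_sq, betaSq_sq_lt, betaSq_lt]

theorem shiftedCoeff_one_lt : shiftedCoeff 1 < 0.816 := by
  nlinarith [shiftedCoeff_one, lt_betaSq, lt_betaSq_sq, betaSq_sq_lt, betaSq_lt]

/-- The only negative term, 2q^{m+1}e_{m-1}, is dominated by the single pair (m-1, 1): since q^{m+1}
≤ 1/4 and e_1 > 0.81, one has e_1(1 - q^{m+1}) ≥ 2q^{m+1}. -/
theorem shiftedCoeff_nonneg (m : ℕ) : 0 ≤ shiftedCoeff m := by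
  induction m using Nat.strong_induction_on with
  | _ m ih =>
    rcases Nat.lt_or_ge m 2 with hm | hm
    · interval_cases m
      · exact shiftedCoeff_zero.ge
      · linarith [lt_shiftedCoeff_one]
    · refine nonneg_of_mul_nonneg_left ?_ (shiftedCoeff_denom_pos (m := m) (by omega))
      rw [shiftedCoeff_rec hm, sub_nonneg]
      have key : shiftedCoeff (m - 1) * shiftedCoeff 1 * (1 - betaSq ^ (m - 1 + 2 * 1)) ≤
          ∑ p ∈ Finset.HasAntidiagonal.antidiagonal m, shiftedCoeff p.1 * shiftedCoeff p.2 * (1 - betaSq ^ (p.1 + 2 * p.2)) := by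
        refine Finset.single_le_sum
          (f := fun p : ℕ × ℕ => shiftedCoeff p.1 * shiftedCoeff p.2 * (1 - betaSq ^ (p.1 + 2 * p.2)))
          (fun p hp => ?_) (a := (m - 1, 1)) (by simp; omega)
        have hp' := Finset.HasAntidiagonal.mem_antidiagonal.1 hp
        have hq : betaSq ^ (p.1 + 2 * p.2) ≤ 1 := pow_le_one₀ betaSq_pos.le betaSq_lt_one.le
        rcases Nat.eq_zero_or_pos p.1 with h1 | h1
        · simp [h1, shiftedCoeff_zero]
        rcases Nat.eq_zero_or_pos p.2 with h2 | h2
        · simp [h2, shiftedCoeff_zero]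
        exact mul_nonneg (mul_nonneg (ih _ (by omega)) (ih _ (by omega))) (by linarith)
      refine le_trans ?_ key
      rw [show m - 1 + 2 * 1 = m + 1 by omega]
      have h3 : betaSq ^ (m + 1) ≤ 1 / 4 := betaSq_pow_three ▸ betaSq_pow_le (by omega)
      have h4 := ih (m - 1) (by omega)
      have h5 := lt_shiftedCoeff_one
      rw [mul_comm _ (shiftedCoeff (m - 1)), mul_assoc]
      refine mul_le_mul_of_nonneg_left ?_ h4
      nlinarith

theorem shiftedCoeff_mul_denom_le {m : ℕ} (hm : 2 ≤ m) :
    shiftedCoeff m * (2 - betaSq ^ m - betaSq ^ (2 * m)) ≤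
      ∑ p ∈ Finset.HasAntidiagonal.antidiagonal m, shiftedCoeff p.1 * shiftedCoeff p.2 := by
  rw [shiftedCoeff_rec hm]
  have h1 : 0 ≤ 2 * betaSq ^ (m + 1) * shiftedCoeff (m - 1) :=
    mul_nonneg (mul_nonneg two_pos.le (pow_pos betaSq_pos _).le) (shiftedCoeff_nonneg _)
  have h2 : ∑ p ∈ Finset.HasAntidiagonal.antidiagonal m, shiftedCoeff p.1 * shiftedCoeff p.2 * (1 - betaSq ^ (p.1 + 2 * p.2)) ≤
      ∑ p ∈ Finset.HasAntidiagonal.antidiagonal m, shiftedCoeff p.1 * shiftedCoeff p.2 := by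
    refine Finset.sum_le_sum fun p _ => mul_le_of_le_one_right
      (mul_nonneg (shiftedCoeff_nonneg _) (shiftedCoeff_nonneg _)) ?_
    linarith [pow_pos betaSq_pos (p.1 + 2 * p.2)]
  linarith

theorem shiftedCoeff_le {m : ℕ} (hm : 2 ≤ m) :
    shiftedCoeff m ≤ ∑ p ∈ Finset.HasAntidiagonal.antidiagonal m, shiftedCoeff p.1 * shiftedCoeff p.2 := by
  refine le_trans ?_ (shiftedCoeff_mul_denom_le hm)
  refine le_mul_of_one_le_right (shiftedCoeff_nonneg m) ?_
  have h1 : betaSq ^ m ≤ betaSq ^ 2 := betaSq_pow_le hm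
  have h2 : betaSq ^ (2 * m) ≤ betaSq ^ 2 := betaSq_pow_le (by omega)
  linarith [betaSq_sq_lt]

/-- The factor 2 - q^m - q^{2m} tends to 2. The threshold 1/2 is what allows sums up to 1 later: y =
y²/2 + const stays solvable as long as y < 1. -/
theorem eventually_shiftedCoeff_le {c : ℝ} (hc : 1 / 2 < c) :
    ∀ᶠ m in atTop, shiftedCoeff m ≤ c * ∑ p ∈ Finset.HasAntidiagonal.antidiagonal m, shiftedCoeff p.1 * shiftedCoeff p.2 := by
  have h1 : Tendsto (fun m => betaSq ^ m) atTop (𝓝 0) :=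
    tendsto_pow_atTop_nhds_zero_of_lt_one betaSq_pos.le betaSq_lt_one
  have h2 : Tendsto (fun m => c * (2 - betaSq ^ m - betaSq ^ (2 * m))) atTop
      (𝓝 (c * (2 - 0 - 0))) :=
    ((tendsto_const_nhds.sub h1).sub
      (h1.comp (tendsto_id.const_mul_atTop' two_pos))).const_mul c
  filter_upwards [h2.eventually_const_le (u := 1) (by linarith), eventually_ge_atTop 2] with m h3 hm
  calc shiftedCoeff m ≤ shiftedCoeff m * (c * (2 - betaSq ^ m - betaSq ^ (2 * m))) :=
        le_mul_of_one_le_right (shiftedCoeff_nonneg m) h3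
    _ = c * (shiftedCoeff m * (2 - betaSq ^ m - betaSq ^ (2 * m))) := by ring
    _ ≤ _ := mul_le_mul_of_nonneg_left (shiftedCoeff_mul_denom_le hm) (by linarith)

/-! ### Quadratic bounds for power series with non-negative coefficients -/

/-- As f and g vanish at 0, a contributing pair with sum at most N has both entries below N. This
gain of one index lets bounds on partial sums be proved by induction on N. -/
theorem sum_range_succ_convolution_le {f g : ℕ → ℝ} (hf : ∀ n, 0 ≤ f n) (hg : ∀ n, 0 ≤ g n)
    (hf0 : f 0 = 0) (hg0 : g 0 = 0) {y : ℝ} (hy : 0 ≤ y) (N : ℕ) :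
    ∑ m ∈ Finset.range (N + 1), (∑ p ∈ Finset.HasAntidiagonal.antidiagonal m, f p.1 * g p.2) * y ^ m ≤
      (∑ m ∈ Finset.range N, f m * y ^ m) * ∑ m ∈ Finset.range N, g m * y ^ m := by
  rw [Finset.sum_mul_sum, ← Finset.sum_product']
  refine le_trans (Finset.sum_le_sum fun m hm => ?_)
    (Finset.sum_fiberwise_le_sum_of_sum_fiber_nonneg (t := Finset.range (N + 1))
      (g := fun p : ℕ × ℕ => p.1 + p.2) fun _ _ => Finset.sum_nonneg fun p _ => ?_)
  · rw [Finset.sum_mul]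
    refine le_of_eq ?_
    symm
    have : ∀ p ∈ Finset.HasAntidiagonal.antidiagonal m, f p.1 * g p.2 * y ^ m =
        f p.1 * y ^ p.1 * (g p.2 * y ^ p.2) := fun p hp => by
      rw [← Finset.HasAntidiagonal.mem_antidiagonal.1 hp, pow_add]; ring
    rw [Finset.sum_congr rfl this]
    refine Finset.sum_subset (fun p hp => ?_) fun p hp hp' => ?_
    · simpa using (Finset.mem_filter.1 hp).2
    · simp only [Finset.HasAntidiagonal.mem_antidiagonal] at hp
      simp only [Finset.mem_filter, Finset.mem_product, Finset.mem_range, hp, and_true] at hp' hm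
      rcases Nat.eq_zero_or_pos p.1 with h1 | h1
      · simp [h1, hf0]
      rcases Nat.eq_zero_or_pos p.2 with h2 | h2
      · simp [h2, hg0]
      omega
  · exact mul_nonneg (mul_nonneg (hf _) (pow_nonneg hy _)) (mul_nonneg (hg _) (pow_nonneg hy _))

/-- Cut f = u + v at a large M. The head u is a polynomial, so its sum and the part of its square
above M stay controlled slightly beyond r. The tail sum T of v satisfies T ≤ c(UU + 2HT + T²), where
H is the head sum and UU the part of its square above M; as H < 1 and c is close to 1/2, this keeps
T small. -/
theorem exists_gt_sum_le_one {f : ℕ → ℝ} (hf : ∀ n, 0 ≤ f n) (hf0 : f 0 = 0)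
    (hconv : ∀ c : ℝ, 1 / 2 < c →
      ∀ᶠ m in atTop, f m ≤ c * ∑ p ∈ Finset.HasAntidiagonal.antidiagonal m, f p.1 * f p.2)
    {r : ℝ} (hr : 0 < r) (hs : Summable fun m => f m * r ^ m) (hlt : ∑' m, f m * r ^ m < 1) :
    ∃ ρ, r < ρ ∧ ∀ N, ∑ m ∈ Finset.range N, f m * ρ ^ m ≤ 1 := by
  obtain ⟨s, hs'⟩ : ∃ s, s = ∑' m, f m * r ^ m := ⟨_, rfl⟩
  have hterm : ∀ n, 0 ≤ f n * r ^ n := fun n => mul_nonneg (hf n) (pow_nonneg hr.le n)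
  have hs0 : 0 ≤ s := hs' ▸ tsum_nonneg hterm
  rw [← hs'] at hlt
  -- With s = 1 - 4δ, a margin δ remains for the head (at most 1 - 3δ), and the tail will be at most
  -- δ.
  obtain ⟨δ, hδ⟩ : ∃ δ, δ = (1 - s) / 4 := ⟨_, rfl⟩
  have hδ0 : 0 < δ := by linarith
  have hδ1 : δ ≤ 1 / 4 := by linarith
  -- the tail of the Cauchy square is small at `r`
  have hsq : Summable fun m => (∑ p ∈ Finset.HasAntidiagonal.antidiagonal m, f p.1 * f p.2) * r ^ m := by
    have h := summable_norm_sum_mul_antidiagonal_of_summable_norm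
      (f := fun m => f m * r ^ m) (g := fun m => f m * r ^ m) hs.norm hs.norm
    refine h.of_norm.congr fun m => ?_
    rw [Finset.sum_mul]
    refine Finset.sum_congr rfl fun p hp => ?_
    rw [← Finset.HasAntidiagonal.mem_antidiagonal.1 hp, pow_add]; ring
  have hsq0 : ∀ m, 0 ≤ (∑ p ∈ Finset.HasAntidiagonal.antidiagonal m, f p.1 * f p.2) * r ^ m := fun m =>
    mul_nonneg (Finset.sum_nonneg fun p _ => mul_nonneg (hf _) (hf _)) (pow_nonneg hr.le _)
  have htail := tendsto_sum_nat_add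
    fun m => (∑ p ∈ Finset.HasAntidiagonal.antidiagonal m, f p.1 * f p.2) * r ^ m
  obtain ⟨M, hM1, hM2⟩ := ((htail.eventually_lt_const (u := δ ^ 2) (by positivity)).and
    (eventually_forall_ge_atTop.2 (hconv ((1 + δ) / 2) (by linarith)))).exists
  obtain ⟨u, hu⟩ : ∃ u : ℕ → ℝ, u = fun m => if m < M then f m else 0 := ⟨_, rfl⟩
  obtain ⟨v, hv⟩ : ∃ v : ℕ → ℝ, v = fun m => if m < M then 0 else f m := ⟨_, rfl⟩
  have hu0 : ∀ n, 0 ≤ u n := fun n => by rw [hu]; dsimp only; split_ifs <;> simp [hf]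
  have hv0 : ∀ n, 0 ≤ v n := fun n => by rw [hv]; dsimp only; split_ifs <;> simp [hf]
  have huf : ∀ n, u n ≤ f n := fun n => by rw [hu]; dsimp only; split_ifs <;> simp [hf]
  have huv : ∀ n, f n = u n + v n := fun n => by rw [hu, hv]; dsimp only; split_ifs <;> simp
  have hu00 : u 0 = 0 := by rw [hu]; simp [hf0]
  have hv00 : v 0 = 0 := by rw [hv]; simp [hf0]
  have huM : ∀ n, M ≤ n → u n = 0 := fun n hn => by rw [hu]; simp [hn]
  have hvM : ∀ n, n < M → v n = 0 := fun n hn => by rw [hv]; simp [hn]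
  have hvM' : ∀ n, M ≤ n → v n = f n := fun n hn => by rw [hv]; simp [hn]
  -- choice of `ρ`
  have hH : ∑ m ∈ Finset.range M, u m * r ^ m < 1 - 3 * δ := by
    calc ∑ m ∈ Finset.range M, u m * r ^ m ≤ ∑ m ∈ Finset.range M, f m * r ^ m :=
          Finset.sum_le_sum fun m _ => mul_le_mul_of_nonneg_right (huf m) (pow_nonneg hr.le m)
      _ ≤ s := hs' ▸ hs.sum_le_tsum _ fun m _ => hterm m
      _ < 1 - 3 * δ := by linarith
  have hUU : ∑ m ∈ Finset.range M,
      (∑ p ∈ Finset.HasAntidiagonal.antidiagonal (m + M), u p.1 * u p.2) * r ^ (m + M) < δ ^ 2 := by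
    refine lt_of_le_of_lt ?_ hM1
    refine le_trans (Finset.sum_le_sum fun m _ => ?_)
      (((summable_nat_add_iff M).2 hsq).sum_le_tsum (Finset.range M) fun m _ => hsq0 _)
    refine mul_le_mul_of_nonneg_right (Finset.sum_le_sum fun p _ => ?_) (pow_nonneg hr.le _)
    exact mul_le_mul (huf _) (huf _) (hu0 _) (hf _)
  have hcont1 : Continuous fun y : ℝ => ∑ m ∈ Finset.range M, u m * y ^ m := by fun_prop
  have hcont2 : Continuous fun y : ℝ => ∑ m ∈ Finset.range M,
      (∑ p ∈ Finset.HasAntidiagonal.antidiagonal (m + M), u p.1 * u p.2) * y ^ (m + M) := by fun_prop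
  have hev := ((hcont1.tendsto r).eventually_lt_const hH).and
    ((hcont2.tendsto r).eventually_lt_const hUU)
  obtain ⟨ρ, ⟨hρ1, hρ2⟩, hρ⟩ :=
    ((hev.filter_mono (nhdsWithin_le_nhds (s := Ioi r))).and self_mem_nhdsWithin).exists
  have hρr : r < ρ := hρ
  have hρ0 : 0 ≤ ρ := (hr.trans hρr).le
  have hHN : ∀ N, ∑ m ∈ Finset.range N, u m * ρ ^ m ≤ 1 - 3 * δ := fun N => by
    refine le_trans ?_ hρ1.le
    have h1 : ∀ m, m ∉ Finset.range M → u m * ρ ^ m = 0 := fun m hm => by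
      rw [huM m (by simpa using hm), zero_mul]
    rw [← tsum_eq_sum (L := SummationFilter.unconditional ℕ) h1]
    exact (summable_of_ne_finset_zero h1).sum_le_tsum _
      fun m _ => mul_nonneg (hu0 m) (pow_nonneg hρ0 m)
  -- the square of the head contributes little above `M`
  have hUUN : ∀ N, ∑ m ∈ Finset.range N,
      (∑ p ∈ Finset.HasAntidiagonal.antidiagonal (m + M), u p.1 * u p.2) * ρ ^ (m + M) ≤ δ ^ 2 := fun N => by
    refine le_trans ?_ hρ2.le
    have h1 : ∀ m, m ∉ Finset.range M →
        (∑ p ∈ Finset.HasAntidiagonal.antidiagonal (m + M), u p.1 * u p.2) * ρ ^ (m + M) = 0 := fun m hm => by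
      rw [Finset.sum_eq_zero, zero_mul]
      intro p hp
      have hp' := Finset.HasAntidiagonal.mem_antidiagonal.1 hp
      simp only [Finset.mem_range, not_lt] at hm
      rcases le_or_gt M p.1 with h | h
      · rw [huM _ h, zero_mul]
      · rw [huM p.2 (by omega), mul_zero]
    rw [← tsum_eq_sum (L := SummationFilter.unconditional ℕ) h1]
    exact (summable_of_ne_finset_zero h1).sum_le_tsum _ fun m _ => mul_nonneg
      (Finset.sum_nonneg fun p _ => mul_nonneg (hu0 _) (hu0 _)) (pow_nonneg hρ0 _)
  have hT0 : ∀ N, 0 ≤ ∑ m ∈ Finset.range N, v m * ρ ^ m := fun N =>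
    Finset.sum_nonneg fun m _ => mul_nonneg (hv0 m) (pow_nonneg hρ0 m)
  -- The quadratic bound at indices up to N uses only partial sums below N, so the induction closes.
  have hT : ∀ N, ∑ m ∈ Finset.range N, v m * ρ ^ m ≤ δ := by
    intro N
    induction N with
    | zero => simpa using hδ0.le
    | succ N ih =>
      rcases Nat.lt_or_ge (N + 1) M with hNM | hNM
      · rw [Finset.sum_eq_zero fun m hm => by
          rw [hvM m ((Finset.mem_range.1 hm).trans hNM), zero_mul]]
        exact hδ0.le
      obtain ⟨L, hL⟩ := Nat.exists_eq_add_of_le' hNM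
      have hsplit : ∑ m ∈ Finset.range (N + 1), v m * ρ ^ m =
          ∑ m ∈ Finset.range L, f (m + M) * ρ ^ (m + M) := by
        rw [hL, add_comm, Finset.sum_range_add, Finset.sum_eq_zero fun m hm => by
          rw [hvM m (Finset.mem_range.1 hm), zero_mul], zero_add]
        exact Finset.sum_congr rfl fun m _ => by rw [hvM' _ (by omega), add_comm]
      have hshift : ∀ w : ℕ → ℝ, (∀ m, 0 ≤ w m) →
          ∑ m ∈ Finset.range L, w (m + M) * ρ ^ (m + M) ≤
            ∑ m ∈ Finset.range (N + 1), w m * ρ ^ m := fun w hw => by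
        rw [hL, add_comm, Finset.sum_range_add]
        simp only [add_comm M]
        exact le_add_of_nonneg_left
          (Finset.sum_nonneg fun m _ => mul_nonneg (hw m) (pow_nonneg hρ0 m))
      have huvN := (hshift (fun m => ∑ p ∈ Finset.HasAntidiagonal.antidiagonal m, u p.1 * v p.2)
        fun m => Finset.sum_nonneg fun p _ => mul_nonneg (hu0 _) (hv0 _)).trans
          (sum_range_succ_convolution_le hu0 hv0 hu00 hv00 hρ0 N)
      have hvuN := (hshift (fun m => ∑ p ∈ Finset.HasAntidiagonal.antidiagonal m, v p.1 * u p.2)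
        fun m => Finset.sum_nonneg fun p _ => mul_nonneg (hv0 _) (hu0 _)).trans
          (sum_range_succ_convolution_le hv0 hu0 hv00 hu00 hρ0 N)
      have hvvN := (hshift (fun m => ∑ p ∈ Finset.HasAntidiagonal.antidiagonal m, v p.1 * v p.2)
        fun m => Finset.sum_nonneg fun p _ => mul_nonneg (hv0 _) (hv0 _)).trans
          (sum_range_succ_convolution_le hv0 hv0 hv00 hv00 hρ0 N)
      have hexp : ∀ m, ∑ p ∈ Finset.HasAntidiagonal.antidiagonal m, f p.1 * f p.2 =
          ∑ p ∈ Finset.HasAntidiagonal.antidiagonal m, u p.1 * u p.2 + ∑ p ∈ Finset.HasAntidiagonal.antidiagonal m, u p.1 * v p.2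
          + ∑ p ∈ Finset.HasAntidiagonal.antidiagonal m, v p.1 * u p.2
          + ∑ p ∈ Finset.HasAntidiagonal.antidiagonal m, v p.1 * v p.2 := fun m => by
        simp only [← Finset.sum_add_distrib]
        exact Finset.sum_congr rfl fun p _ => by rw [huv p.1, huv p.2]; ring
      have hbound : ∑ m ∈ Finset.range L, f (m + M) * ρ ^ (m + M) ≤ (1 + δ) / 2 *
          ∑ m ∈ Finset.range L,
            (∑ p ∈ Finset.HasAntidiagonal.antidiagonal (m + M), f p.1 * f p.2) * ρ ^ (m + M) := by
        rw [Finset.mul_sum]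
        refine Finset.sum_le_sum fun m _ => ?_
        rw [← mul_assoc]
        exact mul_le_mul_of_nonneg_right (hM2 _ (by omega)) (pow_nonneg hρ0 _)
      simp only [hexp, add_mul, Finset.sum_add_distrib] at hbound
      have h1 := hHN N
      have h2 := hUUN L
      have h3 := hT0 N
      have h4 := mul_le_mul h1 ih h3 (by linarith : (0 : ℝ) ≤ 1 - 3 * δ)
      have h5 := mul_le_mul ih ih h3 hδ0.le
      rw [mul_comm] at hvuN
      rw [hsplit]
      refine hbound.trans ?_
      -- The left side equals δ - δ² - 2δ³.
      have h6 : (1 + δ) / 2 * (δ ^ 2 + (1 - 3 * δ) * δ + (1 - 3 * δ) * δ + δ * δ) ≤ δ := by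
        nlinarith [mul_pos hδ0 hδ0, pow_pos hδ0 3]
      refine le_trans (mul_le_mul_of_nonneg_left ?_ (by linarith)) h6
      linarith
  refine ⟨ρ, hρr, fun N => ?_⟩
  simp only [huv, add_mul, Finset.sum_add_distrib]
  linarith [hHN N, hT N]

/-! ### The recurrence for the signed coefficients -/

/-- The two end terms carry the unknown c_m, with total weight 2 - q^m - q^{2m}; this isolates it
from the earlier coefficients. -/
theorem sum_antidiagonal_eq_ends_add {m : ℕ} (hm : 1 ≤ m) (F : ℕ × ℕ → ℝ) :
    ∑ p ∈ Finset.HasAntidiagonal.antidiagonal m, F p =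
      F (0, m) + F (m, 0) + ∑ i ∈ Finset.range (m - 1), F (i + 1, m - 1 - i) := by
  obtain ⟨n, rfl⟩ := Nat.exists_eq_add_of_le' hm
  rw [Finset.Nat.sum_antidiagonal_eq_sum_range_succ_mk, Finset.sum_range_succ,
    Finset.sum_range_succ']
  simp only [Nat.add_sub_cancel, Nat.sub_self, Nat.sub_zero]
  rw [Finset.sum_congr rfl fun i _ => by rw [Nat.add_sub_add_right]]
  ring

/-- The normalisation and the quadratic recurrence of the coefficients of `x h(x)`. -/
structure IsSignedCoefficients (c : ℕ → ℝ) : Prop where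
  zero : c 0 = 1
  relation : ∀ m, 1 ≤ m → ∑ p ∈ Finset.HasAntidiagonal.antidiagonal m,
    c p.1 * c p.2 * (1 - betaSq ^ (p.1 + 2 * p.2)) = -(2 * betaSq ^ (m + 1) * c (m - 1))

theorem IsSignedCoefficients.unique {c c' : ℕ → ℝ} (hc : IsSignedCoefficients c)
    (hc' : IsSignedCoefficients c') : c = c' := by
  funext m
  induction m using Nat.strong_induction_on with
  | _ m ih =>
    rcases Nat.eq_zero_or_pos m with rfl | hm
    · rw [hc.zero, hc'.zero]
    have h := hc.relation m hm
    have h' := hc'.relation m hm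
    rw [sum_antidiagonal_eq_ends_add hm] at h h'
    have hsum : ∑ i ∈ Finset.range (m - 1),
          c (i + 1) * c (m - 1 - i) * (1 - betaSq ^ (i + 1 + 2 * (m - 1 - i))) =
        ∑ i ∈ Finset.range (m - 1),
          c' (i + 1) * c' (m - 1 - i) * (1 - betaSq ^ (i + 1 + 2 * (m - 1 - i))) :=
      Finset.sum_congr rfl fun i hi => by
        have := Finset.mem_range.1 hi
        rw [ih (i + 1) (by omega), ih (m - 1 - i) (by omega)]
    have h0 := shiftedCoeff_denom_pos (m := m) hm
    simp only [hc.zero, hc'.zero, ih (m - 1) (by omega), hsum, zero_add, mul_zero, add_zero] at h h'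
    refine mul_right_cancel₀ h0.ne' ?_
    linarith

/-- The coefficients of `x h(x)`. -/
noncomputable def signedCoeff (m : ℕ) : ℝ := if m = 0 then 1 else -shiftedCoeff m

theorem signedCoeff_of_pos {m : ℕ} (hm : 1 ≤ m) : signedCoeff m = -shiftedCoeff m :=
  if_neg (by omega)

theorem isSignedCoefficients_signedCoeff : IsSignedCoefficients signedCoeff where
  zero := if_pos rfl
  relation m hm := by
    have h0 : signedCoeff 0 = 1 := if_pos rfl
    rw [sum_antidiagonal_eq_ends_add hm]
    dsimp only
    rcases Nat.lt_or_ge m 2 with h | h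
    · obtain rfl : m = 1 := by omega
      simp only [Nat.sub_self, Finset.range_zero, Finset.sum_empty, h0, signedCoeff_of_pos le_rfl]
      linear_combination -shiftedCoeff_one
    · have hr := shiftedCoeff_rec h
      rw [sum_antidiagonal_eq_ends_add hm] at hr
      dsimp only at hr
      have hsum : ∑ i ∈ Finset.range (m - 1), signedCoeff (i + 1) * signedCoeff (m - 1 - i) *
            (1 - betaSq ^ (i + 1 + 2 * (m - 1 - i))) =
          ∑ i ∈ Finset.range (m - 1), shiftedCoeff (i + 1) * shiftedCoeff (m - 1 - i) *
            (1 - betaSq ^ (i + 1 + 2 * (m - 1 - i))) :=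
        Finset.sum_congr rfl fun i hi => by
          have := Finset.mem_range.1 hi
          rw [signedCoeff_of_pos (by omega), signedCoeff_of_pos (by omega)]
          ring
      rw [hsum, signedCoeff_of_pos hm, signedCoeff_of_pos (m := m - 1) (by omega), h0]
      rw [shiftedCoeff_zero] at hr
      simp only [zero_add, mul_zero, add_zero]
      linear_combination -hr

theorem beta_zpow_eq (k i : ℤ) (n : ℕ) (h : k + i = n - 3) :
    beta ^ (2 * k + 2 * i) = 4 * betaSq ^ n := by
  have hb := beta_pos.ne'
  rw [show 2 * k + 2 * i = 2 * (n : ℤ) - 6 by omega, zpow_sub₀ hb, zpow_mul, zpow_natCast]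
  have h6 : beta ^ (6 : ℤ) = 1 / 4 := by
    rw [← betaSq_pow_three, betaSq, ← pow_mul]; norm_cast
  rw [h6, betaSq]
  norm_cast
  ring

/-- Reindexing by c_m = -d_{m-1} and m = k + 2, so that k ≥ -1 becomes m ≥ 1. As β⁻⁶ = 4, the weight
4 - β^{2k+2i} is 4(1 - q^{k+i+3}). -/
theorem isSeriesCoefficients_iff (d : ℤ → ℝ) :
    IsSeriesCoefficients d ↔
      (∀ k, k < -1 → d k = 0) ∧ IsSignedCoefficients fun m : ℕ => -d (m - 1) := by
  have key : ∀ m : ℕ, 1 ≤ m →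
      (∑ i ∈ Finset.Icc (-1) ((m : ℤ) - 2 + 1),
          d i * d ((m : ℤ) - 2 - i) * (4 - beta ^ (2 * ((m : ℤ) - 2) + 2 * i))
        = 2 * d ((m : ℤ) - 2) * beta ^ (2 * ((m : ℤ) - 2)) ↔
      ∑ p ∈ Finset.HasAntidiagonal.antidiagonal m, -d ((p.1 : ℕ) - 1) * -d ((p.2 : ℕ) - 1) *
        (1 - betaSq ^ (p.1 + 2 * p.2)) = -(2 * betaSq ^ (m + 1) * -d ((m - 1 : ℕ) - 1))) := by
    intro m hm
    have h1 : ∑ i ∈ Finset.Icc (-1) ((m : ℤ) - 2 + 1),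
          d i * d ((m : ℤ) - 2 - i) * (4 - beta ^ (2 * ((m : ℤ) - 2) + 2 * i)) =
        4 * ∑ p ∈ Finset.HasAntidiagonal.antidiagonal m, -d ((p.1 : ℕ) - 1) * -d ((p.2 : ℕ) - 1) *
          (1 - betaSq ^ (p.1 + 2 * p.2)) := by
      -- The swap is needed because the index i + 1 is the one that enters the exponent twice.
      rw [← Finset.Nat.sum_antidiagonal_swap, Finset.mul_sum]
      refine Finset.sum_bij' (fun i _ => ((i + 1).toNat, (m - (i + 1)).toNat))
        (fun p _ => (p.1 : ℤ) - 1) ?_ ?_ ?_ ?_ ?_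
      · intro i hi
        rw [Finset.mem_Icc] at hi
        simp only [Finset.HasAntidiagonal.mem_antidiagonal]
        omega
      · intro p hp
        rw [Finset.HasAntidiagonal.mem_antidiagonal] at hp
        rw [Finset.mem_Icc]
        omega
      · intro i hi
        rw [Finset.mem_Icc] at hi
        dsimp only
        omega
      · intro p hp
        rw [Finset.HasAntidiagonal.mem_antidiagonal] at hp
        ext <;> dsimp only <;> omega
      · intro i hi
        rw [Finset.mem_Icc] at hi
        rw [beta_zpow_eq _ _ ((m - (i + 1)).toNat + 2 * (i + 1).toNat) (by omega)]
        simp only [Prod.fst_swap, Prod.snd_swap]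
        rw [show (((i + 1).toNat : ℕ) : ℤ) - 1 = i by omega,
          show (((m - (i + 1)).toNat : ℕ) : ℤ) - 1 = m - 2 - i by omega]
        ring
    have h2 : beta ^ (2 * ((m : ℤ) - 2)) = 4 * betaSq ^ (m + 1) := by
      rw [← beta_zpow_eq ((m : ℤ) - 2) 0 (m + 1) (by push_cast; ring)]
      simp
    rw [h1, h2, show ((m - 1 : ℕ) : ℤ) - 1 = m - 2 by omega]
    constructor <;> intro h <;> linarith
  constructor
  · rintro ⟨h0, h1, h2⟩
    refine ⟨h0, by simp [h1], fun m hm => (key m hm).1 (h2 (m - 2) (by omega))⟩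
  · rintro ⟨h0, h1, h2⟩
    refine ⟨h0, by simpa [neg_eq_iff_eq_neg] using h1, fun k hk => ?_⟩
    have := (key (k + 2).toNat (by omega)).2 (h2 (k + 2).toNat (by omega))
    rwa [show (((k + 2).toNat : ℕ) : ℤ) = k + 2 by omega, show k + 2 - 2 = k by ring] at this

/-- The coefficients `d_k` of the expansion of `-h` at `0`. -/
noncomputable def seriesCoeff (k : ℤ) : ℝ :=
  if k < -1 then 0 else -signedCoeff (k + 1).toNat

theorem seriesCoeff_natCast (k : ℕ) : seriesCoeff k = shiftedCoeff (k + 1) := by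
  rw [seriesCoeff, if_neg (by omega), show ((k : ℤ) + 1).toNat = k + 1 by omega,
    signedCoeff_of_pos (by omega), neg_neg]

theorem isSeriesCoefficients_seriesCoeff : IsSeriesCoefficients seriesCoeff := by
  refine (isSeriesCoefficients_iff _).2 ⟨fun k hk => if_pos hk, ?_⟩
  have : (fun m : ℕ => -seriesCoeff (m - 1)) = signedCoeff := by
    funext m
    rw [seriesCoeff, if_neg (by omega), neg_neg, sub_add_cancel, Int.toNat_natCast]
  rw [this]
  exact isSignedCoefficients_signedCoeff

theorem IsSeriesCoefficients.unique {d d' : ℤ → ℝ} (hd : IsSeriesCoefficients d)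
    (hd' : IsSeriesCoefficients d') : d = d' := by
  obtain ⟨h0, h1⟩ := (isSeriesCoefficients_iff d).1 hd
  obtain ⟨h0', h1'⟩ := (isSeriesCoefficients_iff d').1 hd'
  funext k
  rcases lt_or_ge k (-1) with hk | hk
  · rw [h0 k hk, h0' k hk]
  · have := congrFun (h1.unique h1') (k + 1).toNat
    rw [show (((k + 1).toNat : ℕ) : ℤ) - 1 = k by omega] at this
    exact neg_injective this

/-! ### The radius -/

/-- The non-negative reals at which all partial sums of `∑ e_m y^m` are at most `1`. -/
def subunitSet : Set ℝ :=
  {y | 0 ≤ y ∧ ∀ N, ∑ m ∈ Finset.range N, shiftedCoeff m * y ^ m ≤ 1}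

/-- The positive zero of `h`. -/
noncomputable def dyadicRadius : ℝ := sSup subunitSet

theorem quarter_mem_subunitSet : 1 / 4 ∈ subunitSet := by
  -- The bound 1/2 reproduces itself: e_1/4 ≤ 1/4, and the other terms contribute at most (1/2)².
  refine ⟨by norm_num, fun N => le_trans (b := 1 / 2) ?_ (by norm_num)⟩
  induction N with
  | zero => simp
  | succ N ih =>
    have hterm : ∀ m, 0 ≤ shiftedCoeff m * (1 / 4 : ℝ) ^ m := fun m =>
      mul_nonneg (shiftedCoeff_nonneg m) (by positivity)
    have h1 : ∑ m ∈ Finset.range (N + 1), shiftedCoeff m * (1 / 4 : ℝ) ^ m ≤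
        ∑ m ∈ Finset.range (N + 1), ((if m = 1 then 1 / 4 else 0) +
          (∑ p ∈ Finset.HasAntidiagonal.antidiagonal m, shiftedCoeff p.1 * shiftedCoeff p.2) *
            (1 / 4 : ℝ) ^ m) := by
      refine Finset.sum_le_sum fun m _ => ?_
      have hconv : 0 ≤
          (∑ p ∈ Finset.HasAntidiagonal.antidiagonal m, shiftedCoeff p.1 * shiftedCoeff p.2) *
            (1 / 4 : ℝ) ^ m := mul_nonneg (Finset.sum_nonneg fun p _ =>
              mul_nonneg (shiftedCoeff_nonneg _) (shiftedCoeff_nonneg _)) (by positivity)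
      rcases Nat.lt_or_ge m 2 with hm | hm
      · interval_cases m
        · simp [shiftedCoeff_zero]
        · rw [if_pos rfl]
          linarith [shiftedCoeff_one_lt]
      · rw [if_neg (by omega), zero_add]
        exact mul_le_mul_of_nonneg_right (shiftedCoeff_le hm) (by positivity)
    rw [Finset.sum_add_distrib] at h1
    have h2 := sum_range_succ_convolution_le shiftedCoeff_nonneg shiftedCoeff_nonneg
      shiftedCoeff_zero shiftedCoeff_zero (y := 1 / 4) (by norm_num) N
    have h3 : ∑ m ∈ Finset.range (N + 1), (if m = 1 then (1 / 4 : ℝ) else 0) ≤ 1 / 4 := by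
      rw [Finset.sum_ite_eq']
      split_ifs <;> norm_num
    have h4 := mul_le_mul ih ih (Finset.sum_nonneg fun m _ => hterm m) (by norm_num)
    linarith

theorem bddAbove_subunitSet : BddAbove subunitSet := by
  refine ⟨2, fun y hy => ?_⟩
  have := hy.2 2
  rw [Finset.sum_range_succ, Finset.sum_range_one, shiftedCoeff_zero, zero_mul, zero_add,
    pow_one] at this
  nlinarith [lt_shiftedCoeff_one, hy.1]

theorem dyadicRadius_mem : dyadicRadius ∈ subunitSet := by
  refine IsClosed.csSup_mem ?_ ⟨_, quarter_mem_subunitSet⟩ bddAbove_subunitSet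
  rw [subunitSet, ofPred_and]
  refine isClosed_Ici.inter ?_
  simp only [ofPred_forall]
  exact isClosed_iInter fun N => isClosed_le (by fun_prop) continuous_const

theorem dyadicRadius_pos : 0 < dyadicRadius :=
  lt_of_lt_of_le (by norm_num) (le_csSup bddAbove_subunitSet quarter_mem_subunitSet)

theorem summable_dyadicRadius : Summable fun m => shiftedCoeff m * dyadicRadius ^ m :=
  summable_of_sum_range_le
    (fun m => mul_nonneg (shiftedCoeff_nonneg m) (pow_nonneg dyadicRadius_pos.le m))
    dyadicRadius_mem.2

/-- A sum below 1 could be continued to the right of the supremum by `exists_gt_sum_le_one`. -/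
theorem tsum_dyadicRadius : ∑' m, shiftedCoeff m * dyadicRadius ^ m = 1 := by
  refine le_antisymm (Real.tsum_le_of_sum_range_le (fun m => mul_nonneg (shiftedCoeff_nonneg m)
    (pow_nonneg dyadicRadius_pos.le m)) dyadicRadius_mem.2) (not_lt.1 fun h => ?_)
  obtain ⟨ρ, hρ, hρ'⟩ := exists_gt_sum_le_one shiftedCoeff_nonneg shiftedCoeff_zero
    (fun _ => eventually_shiftedCoeff_le) dyadicRadius_pos summable_dyadicRadius h
  exact hρ.not_ge (le_csSup bddAbove_subunitSet ⟨(dyadicRadius_pos.trans hρ).le, hρ'⟩)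

/-! ### The functions `x h(x)` and `h` -/

/-- The function `x h(x) = 1 - ∑ d_k x^{k+1}`. -/
noncomputable def profileNum (x : ℝ) : ℝ := 1 - ∑' m, shiftedCoeff m * x ^ m

theorem summable_of_le {x y : ℝ} (hx : 0 ≤ x) (hxy : x ≤ y)
    (hy : Summable fun m => shiftedCoeff m * y ^ m) :
    Summable fun m => shiftedCoeff m * x ^ m :=
  hy.of_nonneg_of_le (fun m => mul_nonneg (shiftedCoeff_nonneg m) (pow_nonneg hx m))
    fun m => mul_le_mul_of_nonneg_left (pow_le_pow_left₀ hx hxy m) (shiftedCoeff_nonneg m)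

theorem summable_of_mem_Icc {x : ℝ} (hx : x ∈ Icc 0 dyadicRadius) :
    Summable fun m => shiftedCoeff m * x ^ m :=
  summable_of_le hx.1 hx.2 summable_dyadicRadius

theorem hasSum_profileNum {x : ℝ} (hx : Summable fun m => shiftedCoeff m * x ^ m) :
    HasSum (fun m => signedCoeff m * x ^ m) (profileNum x) := by
  have h1 : HasSum (fun m : ℕ => if m = 0 then (1 : ℝ) else 0) 1 := hasSum_ite_eq 0 1
  refine (h1.sub hx.hasSum).congr_fun ?_
  intro m
  rcases Nat.eq_zero_or_pos m with rfl | hm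
  · simp [signedCoeff, shiftedCoeff_zero]
  · rw [signedCoeff_of_pos hm, if_neg (by omega)]; ring

/-- The signed recurrence is this identity read coefficientwise through Cauchy products: the weight
1 - q^{i+2j} is the difference between g(x)² and g(qx)g(q²x). -/
theorem profileNum_sq {x : ℝ} (hx0 : 0 ≤ x) (hx : Summable fun m => shiftedCoeff m * x ^ m) :
    profileNum x ^ 2 = profileNum (betaSq * x) *
      (profileNum (betaSq ^ 2 * x) - 2 * betaSq ^ 2 * x) := by
  have hq := betaSq_pos.le
  have h1 := hasSum_profileNum hx
  have h2 := hasSum_profileNum (summable_of_le (mul_nonneg hq hx0)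
    (mul_le_of_le_one_left hx0 betaSq_lt_one.le) hx)
  have h3 := hasSum_profileNum (summable_of_le (mul_nonneg (pow_nonneg hq 2) hx0)
    (mul_le_of_le_one_left hx0 (pow_le_one₀ hq betaSq_lt_one.le)) hx)
  have p1 := summable_norm_sum_mul_antidiagonal_of_summable_norm h1.summable.norm h1.summable.norm
  have p2 := summable_norm_sum_mul_antidiagonal_of_summable_norm h2.summable.norm h3.summable.norm
  have e1 := tsum_mul_tsum_eq_tsum_sum_antidiagonal_of_summable_norm
    h1.summable.norm h1.summable.norm
  have e2 := tsum_mul_tsum_eq_tsum_sum_antidiagonal_of_summable_norm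
    h2.summable.norm h3.summable.norm
  rw [h1.tsum_eq] at e1
  rw [h2.tsum_eq, h3.tsum_eq] at e2
  have hdiff := (p1.of_norm.hasSum.sub p2.of_norm.hasSum)
  rw [← e1, ← e2] at hdiff
  -- The constant terms of the two products cancel, and the factor x on the right shifts the index
  -- by one.
  have hR := (hasSum_nat_add_iff' 1).2 hdiff
  have hL := h2.mul_left (-(2 * betaSq ^ 2 * x))
  have := hR.unique (hL.congr_fun fun m => ?_)
  · simp only [Finset.range_one, Finset.sum_singleton, pow_zero, mul_one, sub_self, sub_zero, Finset.Nat.antidiagonal_zero] at this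
    linear_combination this
  · have hrel := isSignedCoefficients_signedCoeff.relation (m + 1) (by omega)
    rw [Nat.add_sub_cancel] at hrel
    rw [← Finset.sum_sub_distrib]
    calc _ = (∑ p ∈ Finset.HasAntidiagonal.antidiagonal (m + 1), signedCoeff p.1 * signedCoeff p.2 *
          (1 - betaSq ^ (p.1 + 2 * p.2))) * x ^ (m + 1) := by
          rw [Finset.sum_mul]
          refine Finset.sum_congr rfl fun p hp => ?_
          rw [← Finset.HasAntidiagonal.mem_antidiagonal.1 hp]
          ring
      _ = _ := by rw [hrel]; ring

theorem profileNum_dyadicRadius : profileNum dyadicRadius = 0 := by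
  rw [profileNum, tsum_dyadicRadius, sub_self]

theorem strictAntiOn_profileNum : StrictAntiOn profileNum (Icc 0 dyadicRadius) := by
  intro x hx y hy hxy
  refine sub_lt_sub_left ((summable_of_mem_Icc hx).tsum_lt_tsum (i := 1) (fun m => ?_) ?_
    (summable_of_mem_Icc hy)) 1
  · exact mul_le_mul_of_nonneg_left (pow_le_pow_left₀ hx.1 hxy.le m) (shiftedCoeff_nonneg m)
  · simp only [pow_one]
    exact mul_lt_mul_of_pos_left hxy (by linarith [lt_shiftedCoeff_one])

theorem profileNum_pos {x : ℝ} (hx0 : 0 ≤ x) (hx : x < dyadicRadius) : 0 < profileNum x :=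
  profileNum_dyadicRadius ▸
    strictAntiOn_profileNum ⟨hx0, hx.le⟩ ⟨dyadicRadius_pos.le, le_rfl⟩ hx

/-! ### Locating R through the functional equation -/

theorem profileNum_betaSq_sq :
    profileNum (betaSq ^ 2 * dyadicRadius) = 2 * betaSq ^ 2 * dyadicRadius := by
  have h := profileNum_sq dyadicRadius_pos.le summable_dyadicRadius
  have hpos : 0 < profileNum (betaSq * dyadicRadius) :=
    profileNum_pos (mul_pos betaSq_pos dyadicRadius_pos).le
      (mul_lt_of_lt_one_left dyadicRadius_pos betaSq_lt_one)
  rw [profileNum_dyadicRadius, zero_pow two_ne_zero, zero_eq_mul] at h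
  exact sub_eq_zero.1 (h.resolve_left hpos.ne')

/-- Choose y just above R with qy < R. Then g(qy) > 0, while g(q²y) - 2q²y is negative because it
vanishes at R and decreases. The functional equation would give g(y)² < 0. -/
theorem not_summable_of_dyadicRadius_lt {ρ : ℝ} (hρ : dyadicRadius < ρ) :
    ¬ Summable fun m => shiftedCoeff m * ρ ^ m := by
  intro hs
  have hR := dyadicRadius_pos
  have hq := betaSq_pos
  have h1 : dyadicRadius < min ρ (dyadicRadius / betaSq) :=
    lt_min hρ ((lt_div_iff₀ hq).2 (mul_lt_of_lt_one_right hR betaSq_lt_one))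
  obtain ⟨y, hy1, hy2⟩ := exists_between h1
  have hy0 : 0 < y := hR.trans hy1
  have h2 : betaSq * y < dyadicRadius := by
    have := (lt_div_iff₀ hq).1 (hy2.trans_le (min_le_right _ _))
    linarith
  have h3 : betaSq ^ 2 * y < dyadicRadius := by
    refine lt_of_le_of_lt ?_ h2
    have := betaSq_pow_le (show 1 ≤ 2 by norm_num)
    rw [pow_one] at this
    exact mul_le_mul_of_nonneg_right this hy0.le
  have h4 := profileNum_sq hy0.le (summable_of_le hy0.le (hy2.trans_le (min_le_left _ _)).le hs)
  have h5 : betaSq ^ 2 * dyadicRadius < betaSq ^ 2 * y := mul_lt_mul_of_pos_left hy1 (pow_pos hq 2)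
  have h6 := strictAntiOn_profileNum ⟨(mul_pos (pow_pos hq 2) hR).le, (h5.trans h3).le⟩
    ⟨(mul_pos (pow_pos hq 2) hy0).le, h3.le⟩ h5
  rw [profileNum_betaSq_sq] at h6
  have h7 := mul_neg_of_pos_of_neg (profileNum_pos (mul_pos hq hy0).le h2)
    (show profileNum (betaSq ^ 2 * y) - 2 * betaSq ^ 2 * y < 0 by nlinarith)
  nlinarith [sq_nonneg (profileNum y)]

theorem dyadicRadius_lt_one : dyadicRadius < 1 := by
  have hR := dyadicRadius_pos
  have hmem : betaSq ^ 2 * dyadicRadius ∈ Icc 0 dyadicRadius :=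
    ⟨(mul_pos (pow_pos betaSq_pos 2) hR).le, mul_le_of_le_one_left hR.le
      (pow_le_one₀ betaSq_pos.le betaSq_lt_one.le)⟩
  have h1 := (summable_of_mem_Icc hmem).le_tsum 1
    fun m _ => mul_nonneg (shiftedCoeff_nonneg m) (pow_nonneg hmem.1 m)
  have h2 := profileNum_betaSq_sq
  rw [profileNum] at h2
  rw [pow_one] at h1
  -- Only the term e_1 of the series is kept in g(q²R) = 2q²R.
  have h3 : dyadicRadius * (betaSq ^ 2 * (2 + shiftedCoeff 1)) ≤ 1 := by linarith
  have h4 : 1 < betaSq ^ 2 * (2 + shiftedCoeff 1) := by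
    nlinarith [lt_betaSq_sq, lt_shiftedCoeff_one]
  nlinarith

theorem lt_dyadicRadius : 4 / 5 < dyadicRadius := by
  have hR := dyadicRadius_pos
  have hmem : betaSq ^ 2 * dyadicRadius ∈ Icc 0 dyadicRadius :=
    ⟨(mul_pos (pow_pos betaSq_pos 2) hR).le, mul_le_of_le_one_left hR.le
      (pow_le_one₀ betaSq_pos.le betaSq_lt_one.le)⟩
  have h2 := profileNum_betaSq_sq
  have h1 := (summable_of_mem_Icc hmem).sum_add_tsum_nat_add 2
  have h3 := summable_dyadicRadius.sum_add_tsum_nat_add 2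
  rw [profileNum, ← h1] at h2
  rw [tsum_dyadicRadius] at h3
  simp only [Finset.sum_range_succ, Finset.sum_range_zero, shiftedCoeff_zero, zero_mul, zero_add,
    pow_one] at h2 h3
  -- For m ≥ 2 each term at q²R is at most q⁴ times the term at R, and those sum to 1 - e_1 R.
  have h4 : ∑' m, shiftedCoeff (m + 2) * (betaSq ^ 2 * dyadicRadius) ^ (m + 2) ≤
      betaSq ^ 4 * ∑' m, shiftedCoeff (m + 2) * dyadicRadius ^ (m + 2) := by
    rw [← tsum_mul_left]
    refine Summable.tsum_le_tsum (fun m => ?_)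
      ((summable_nat_add_iff 2).2 (summable_of_mem_Icc hmem))
      (((summable_nat_add_iff 2).2 summable_dyadicRadius).mul_left _)
    rw [mul_pow, ← pow_mul, mul_left_comm]
    exact mul_le_mul_of_nonneg_right (betaSq_pow_le (by omega))
      (mul_nonneg (shiftedCoeff_nonneg _) (pow_nonneg hR.le _))
  have h5 : betaSq ^ 4 < 0.1576 := by
    rw [show betaSq ^ 4 = betaSq ^ 3 * betaSq by ring, betaSq_pow_three]
    linarith [betaSq_lt]
  have h6 : 0.156 < betaSq ^ 4 := by
    rw [show betaSq ^ 4 = betaSq ^ 3 * betaSq by ring, betaSq_pow_three]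
    linarith [lt_betaSq]
  have h7 : 1 - betaSq ^ 4 ≤
      dyadicRadius * (2 * betaSq ^ 2 + shiftedCoeff 1 * (betaSq ^ 2 - betaSq ^ 4)) := by
    rw [show ∑' m, shiftedCoeff (m + 2) * dyadicRadius ^ (m + 2) =
      1 - shiftedCoeff 1 * dyadicRadius by linarith] at h4
    linarith
  have h8 : shiftedCoeff 1 * (betaSq ^ 2 - betaSq ^ 4) < 0.816 * 0.241 :=
    mul_lt_mul'' shiftedCoeff_one_lt (by linarith [betaSq_sq_lt]) (shiftedCoeff_nonneg 1)
      (by linarith [lt_betaSq_sq])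
  nlinarith [betaSq_sq_lt]

/-- For m ≥ 1, (x/R)^m ≤ x/R, and the e_m R^m sum to 1. -/
theorem one_sub_div_le_profileNum {x : ℝ} (hx : x ∈ Icc 0 dyadicRadius) :
    1 - x / dyadicRadius ≤ profileNum x := by
  have hR := dyadicRadius_pos
  refine sub_le_sub_left ?_ 1
  rw [← mul_one (x / dyadicRadius), ← tsum_dyadicRadius, ← tsum_mul_left]
  refine (summable_of_mem_Icc hx).tsum_le_tsum (fun m => ?_) (summable_dyadicRadius.mul_left _)
  rcases Nat.eq_zero_or_pos m with rfl | hm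
  · simp [shiftedCoeff_zero]
  · rw [mul_left_comm]
    refine mul_le_mul_of_nonneg_left ?_ (shiftedCoeff_nonneg m)
    rw [← div_le_iff₀ (pow_pos hR m), ← div_pow]
    exact pow_le_of_le_one (div_nonneg hx.1 hR.le) ((div_le_one hR).2 hx.2) (by omega)

theorem profileNum_le_one {x : ℝ} (hx : 0 ≤ x) : profileNum x ≤ 1 :=
  sub_le_self _ (tsum_nonneg fun m => mul_nonneg (shiftedCoeff_nonneg m) (pow_nonneg hx m))

theorem continuousOn_profileNum : ContinuousOn profileNum (Icc 0 dyadicRadius) := by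
  refine continuousOn_const.sub (continuousOn_tsum (fun m => by fun_prop) summable_dyadicRadius
    fun m x hx => ?_)
  rw [Real.norm_of_nonneg (mul_nonneg (shiftedCoeff_nonneg m) (pow_nonneg hx.1 m))]
  exact mul_le_mul_of_nonneg_left (pow_le_pow_left₀ hx.1 hx.2 m) (shiftedCoeff_nonneg m)

/-- The profile `h(x) = 1/x - ∑ d_k x^k`. -/
noncomputable def profile (x : ℝ) : ℝ := profileNum x / x

theorem profile_dyadicRadius : profile dyadicRadius = 0 := by
  rw [profile, profileNum_dyadicRadius, zero_div]

theorem profile_nonneg {x : ℝ} (hx : x ∈ Ioc 0 dyadicRadius) : 0 ≤ profile x := by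
  refine div_nonneg ?_ hx.1.le
  rcases hx.2.lt_or_eq with h | rfl
  · exact (profileNum_pos hx.1.le h).le
  · exact profileNum_dyadicRadius.ge

theorem hasSum_seriesCoeff {x : ℝ} (hx : x ∈ Ioc 0 dyadicRadius) :
    HasSum (fun k : ℕ => seriesCoeff k * x ^ k) (x⁻¹ - profile x) := by
  have h := (hasSum_nat_add_iff' 1).2 (summable_of_mem_Icc ⟨hx.1.le, hx.2⟩).hasSum
  simp only [Finset.sum_range_one, shiftedCoeff_zero, zero_mul, sub_zero] at h
  have hx' := hx.1.ne'
  have hval : x⁻¹ - profile x = x⁻¹ * ∑' m, shiftedCoeff m * x ^ m := by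
    rw [profile, profileNum]
    field_simp
    ring
  rw [hval]
  refine (h.mul_left x⁻¹).congr_fun fun k => ?_
  rw [seriesCoeff_natCast, pow_succ]
  field_simp

theorem strictAntiOn_profile : StrictAntiOn profile (Ioc 0 dyadicRadius) := by
  intro x hx y hy hxy
  have h1 := strictAntiOn_profileNum ⟨hx.1.le, hx.2⟩ ⟨hy.1.le, hy.2⟩ hxy
  calc profile y = profileNum y / y := rfl
    _ < profileNum x / y := div_lt_div_of_pos_right h1 hy.1
    _ ≤ profileNum x / x := div_le_div_of_nonneg_left
      (profileNum_pos hx.1.le (hxy.trans_le hy.2)).le hx.1 hxy.le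

theorem bijOn_profile : BijOn profile (Ioc 0 dyadicRadius) (Ici 0) := by
  refine ⟨fun x hx => profile_nonneg hx, strictAntiOn_profile.injOn, fun v hv => ?_⟩
  have hv : 0 ≤ v := hv
  have hR := dyadicRadius_pos
  have hw : 0 < v + dyadicRadius⁻¹ := by positivity
  have hle : (v + dyadicRadius⁻¹)⁻¹ ≤ dyadicRadius :=
    inv_le_of_inv_le₀ hR (by linarith)
  have hpos : 0 < (v + dyadicRadius⁻¹)⁻¹ := inv_pos.2 hw
  have hcont : ContinuousOn profile (Icc (v + dyadicRadius⁻¹)⁻¹ dyadicRadius) :=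
    (continuousOn_profileNum.mono (Icc_subset_Icc_left hpos.le)).div continuousOn_id
      fun x hx => (hpos.trans_le hx.1).ne'
  -- Since h(x) ≥ 1/x - 1/R, the point x = (v + 1/R)⁻¹ has h(x) ≥ v.
  have hmem : v ∈ Icc (profile dyadicRadius) (profile (v + dyadicRadius⁻¹)⁻¹) := by
    refine ⟨profile_dyadicRadius.trans_le hv, ?_⟩
    rw [profile, le_div_iff₀ hpos]
    refine le_trans (le_of_eq ?_) (one_sub_div_le_profileNum ⟨hpos.le, hle⟩)
    field_simp
    ring
  obtain ⟨x, hx, rfl⟩ := intermediate_value_Icc' hle hcont hmem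
  exact ⟨x, ⟨hpos.trans_le hx.1, hx.2⟩, rfl⟩

theorem profile_mul_profile {x : ℝ} (hx : x ∈ Ioc 0 dyadicRadius) :
    profile (betaSq * x) * (profile (betaSq ^ 2 * x) - 2) = 4 * profile x ^ 2 := by
  have h := profileNum_sq hx.1.le (summable_of_mem_Icc ⟨hx.1.le, hx.2⟩)
  have hx' := hx.1.ne'
  have hq := betaSq_pos.ne'
  have h3 := betaSq_pow_three
  rw [profile, profile, profile, div_pow, h]
  field_simp
  linear_combination (-4 * profileNum (betaSq * x) *
    (profileNum (betaSq ^ 2 * x) - 2 * betaSq ^ 2 * x)) * h3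

theorem convergenceRadius_seriesCoeff :
    convergenceRadius (fun k : ℕ => seriesCoeff k) = ENNReal.ofReal dyadicRadius := by
  have hR := dyadicRadius_pos
  refine le_antisymm (le_of_not_gt fun h => ?_) ?_
  · obtain ⟨r, hr1, hr2⟩ := ENNReal.lt_iff_exists_nnreal_btwn.1 h
    have hs := FormalMultilinearSeries.summable_norm_mul_pow _ hr2
    simp only [FormalMultilinearSeries.ofScalars_norm, seriesCoeff_natCast,
      Real.norm_of_nonneg (shiftedCoeff_nonneg _)] at hs
    have hlt : dyadicRadius < r := by
      rw [← ENNReal.ofReal_coe_nnreal] at hr1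
      exact (ENNReal.ofReal_lt_ofReal_iff_of_nonneg hR.le).1 hr1
    refine not_summable_of_dyadicRadius_lt hlt ((summable_nat_add_iff 1).1 ?_)
    refine (hs.mul_right (r : ℝ)).congr fun k => ?_
    rw [pow_succ]; ring
  · rw [ENNReal.ofReal]
    refine FormalMultilinearSeries.le_radius_of_summable _ ?_
    simp only [FormalMultilinearSeries.ofScalars_norm, Real.coe_toNNReal _ hR.le]
    refine (hasSum_seriesCoeff ⟨hR, le_rfl⟩).summable.congr fun k => ?_
    rw [seriesCoeff_natCast, Real.norm_of_nonneg (shiftedCoeff_nonneg _)]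

theorem tendsto_profileNum : Tendsto (fun n => profileNum (betaSq ^ n * dyadicRadius)) atTop (𝓝 1) := by
  have h1 : Tendsto (fun n => betaSq ^ n) atTop (𝓝 0) :=
    tendsto_pow_atTop_nhds_zero_of_lt_one betaSq_pos.le betaSq_lt_one
  have h2 : Tendsto (fun n => 1 - betaSq ^ n) atTop (𝓝 (1 - 0)) := tendsto_const_nhds.sub h1
  rw [sub_zero] at h2
  have hR := dyadicRadius_pos
  have h0 : ∀ n, 0 ≤ betaSq ^ n * dyadicRadius := fun n =>
    (mul_pos (pow_pos betaSq_pos n) hR).le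
  refine tendsto_of_tendsto_of_tendsto_of_le_of_le h2 tendsto_const_nhds (fun n => ?_)
    fun n => profileNum_le_one (h0 n)
  have := one_sub_div_le_profileNum (x := betaSq ^ n * dyadicRadius)
    ⟨h0 n, mul_le_of_le_one_left hR.le (pow_le_one₀ betaSq_pos.le betaSq_lt_one.le)⟩
  rwa [mul_div_cancel_right₀ _ hR.ne'] at this

/-! ### The rescaled recurrence -/

/-- The recurrence `b_{n+2} = 2 + 4 b_n² / b_{n+1}` of the rescaled coefficients. -/
structure IsRescaledSequence (b : ℕ → ℝ) : Prop where
  zero : b 0 = 0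
  pos_one : 0 < b 1
  recurrence : ∀ n, b (n + 2) = 2 + 4 * b n ^ 2 / b (n + 1)

namespace IsRescaledSequence

variable {b s : ℕ → ℝ}

theorem pos (hb : IsRescaledSequence b) (n : ℕ) : 0 < b (n + 1) := by
  induction n with
  | zero => exact hb.pos_one
  | succ n ih =>
    rw [hb.recurrence n]
    positivity

theorem unique (hb : IsRescaledSequence b) (hs : IsRescaledSequence s) (h : b 1 = s 1) :
    b = s := by
  have key : ∀ n, b n = s n ∧ b (n + 1) = s (n + 1) := by
    intro n
    induction n with
    | zero => exact ⟨hb.zero.trans hs.zero.symm, h⟩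
    | succ n ih => exact ⟨ih.2, by rw [hb.recurrence, hs.recurrence, ih.1, ih.2]⟩
  exact funext fun n => (key n).1

/-- When b ≤ s at the middle index, the ratio of b - 2 to s - 2 two steps later is at least the
square of the present ratio; restoring the summand 2 costs the factor 1 - 2/s. -/
theorem ratio_sub_one_ge (hb : IsRescaledSequence b) (hs : IsRescaledSequence s) {n : ℕ}
    (h : b (n + 2) ≤ s (n + 2)) :
    (1 - 2 / s (n + 3)) * ((b (n + 1) / s (n + 1)) ^ 2 - 1) ≤ b (n + 3) / s (n + 3) - 1 := by
  have h1 := hs.pos n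
  have h2 := hs.pos (n + 1)
  have h2' := hb.pos (n + 1)
  have h3 := hs.pos (n + 2)
  have hb3 := hb.recurrence (n + 1)
  have hs3 := hs.recurrence (n + 1)
  have h4 : (b (n + 1) / s (n + 1)) ^ 2 * (s (n + 3) - 2) ≤ b (n + 3) - 2 := by
    rw [hb3, hs3, add_sub_cancel_left, add_sub_cancel_left]
    calc (b (n + 1) / s (n + 1)) ^ 2 * (4 * s (n + 1) ^ 2 / s (n + 2))
        = 4 * b (n + 1) ^ 2 / s (n + 2) := by field_simp
      _ ≤ 4 * b (n + 1) ^ 2 / b (n + 2) :=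
        div_le_div_of_nonneg_left (by positivity) h2' h
  have h5 : (1 - 2 / s (n + 3)) * ((b (n + 1) / s (n + 1)) ^ 2 - 1) =
      ((b (n + 1) / s (n + 1)) ^ 2 * (s (n + 3) - 2) + 2) / s (n + 3) - 1 := by
    field_simp
    ring
  rw [h5]
  gcongr
  linarith

theorem lt_step (hb : IsRescaledSequence b) (hs : IsRescaledSequence s) {n : ℕ}
    (h1 : s (n + 1) < b (n + 1)) (h2 : b (n + 2) ≤ s (n + 2)) : s (n + 3) < b (n + 3) := by
  have p1 := hs.pos n
  have p2 := hb.pos (n + 1)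
  rw [hb.recurrence (n + 1), hs.recurrence (n + 1)]
  gcongr

theorem le_step (hb : IsRescaledSequence b) (hs : IsRescaledSequence s) {n : ℕ}
    (h1 : b (n + 1) ≤ s (n + 1)) (h2 : s (n + 2) < b (n + 2)) : b (n + 3) ≤ s (n + 3) := by
  have p1 := hb.pos n
  have p2 := hs.pos (n + 1)
  rw [hb.recurrence (n + 1), hs.recurrence (n + 1)]
  gcongr

theorem two (hb : IsRescaledSequence b) : b 2 = 2 := by
  rw [hb.recurrence 0, hb.zero]
  simp

theorem exists_alternation (hb : IsRescaledSequence b) (hs : IsRescaledSequence s)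
    (h : b 1 ≠ s 1) : ∃ N, s (N + 1) < b (N + 1) ∧ b (N + 2) ≤ s (N + 2) := by
  have h2 : b 2 = s 2 := hb.two.trans hs.two.symm
  rcases h.lt_or_gt with h1 | h1
  · have p1 := hb.pos 0
    have h3 : b 3 < s 3 := by
      rw [hb.recurrence 1, hs.recurrence 1, h2]
      have := hs.pos 1
      gcongr
    have h4 : s 4 < b 4 := by
      rw [hb.recurrence 2, hs.recurrence 2, h2]
      have := hs.pos 1
      have := hb.pos 2
      gcongr
    -- Starting below, b_2 = s_2 delays the overshoot to index 4.
    exact ⟨3, h4, hb.le_step hs (n := 2) h3.le h4⟩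
  · exact ⟨0, h1, h2.le⟩

theorem alternation (hb : IsRescaledSequence b) (hs : IsRescaledSequence s) {N : ℕ}
    (h1 : s (N + 1) < b (N + 1)) (h2 : b (N + 2) ≤ s (N + 2)) (j : ℕ) :
    s (N + 2 * j + 1) < b (N + 2 * j + 1) ∧ b (N + 2 * j + 2) ≤ s (N + 2 * j + 2) := by
  induction j with
  | zero => exact ⟨h1, h2⟩
  | succ j ih =>
    have h3 := hb.lt_step hs ih.1 ih.2
    exact ⟨h3, hb.le_step hs (n := N + 2 * j + 1) ih.2 h3⟩

theorem tendsto_ratio (hb : IsRescaledSequence b) (hs : IsRescaledSequence s)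
    (hlim : Tendsto s atTop atTop) {N : ℕ} (h1 : s (N + 1) < b (N + 1))
    (h2 : b (N + 2) ≤ s (N + 2)) :
    Tendsto (fun j => b (N + 2 * j + 1) / s (N + 2 * j + 1)) atTop atTop := by
  have halt := hb.alternation hs h1 h2
  have hx : ∀ j, 0 < b (N + 2 * j + 1) / s (N + 2 * j + 1) - 1 := fun j =>
    sub_pos.2 ((one_lt_div (hs.pos _)).2 (halt j).1)
  obtain ⟨J, hJ⟩ := eventually_atTop.1 (hlim.eventually_ge_atTop 8)
  have hgeom : Tendsto
      (fun j => b (N + 2 * (j + J) + 1) / s (N + 2 * (j + J) + 1) - 1) atTop atTop := by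
    refine tendsto_atTop_of_geom_le (c := 3 / 2) (hx _) (by norm_num) fun j => ?_
    have h3 := hb.ratio_sub_one_ge hs (halt (j + J)).2
    have h4 := hx (j + J)
    have h5 : 2 / s (N + 2 * (j + J) + 3) ≤ 1 / 4 := by
      -- From s ≥ 8 the factor 1 - 2/s is at least 3/4, and x² - 1 ≥ 2(x - 1) for x ≥ 1; hence the
      -- rate 3/2.
      rw [div_le_iff₀ (hs.pos _)]
      linarith [hJ (N + 2 * (j + J) + 3) (by omega)]
    rw [show N + 2 * (j + 1 + J) + 1 = N + 2 * (j + J) + 3 by ring]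
    refine le_trans ?_ h3
    nlinarith [mul_pos h4 h4]
  have := (tendsto_add_atTop_iff_nat
    (f := fun j => b (N + 2 * j + 1) / s (N + 2 * j + 1) - 1) J).1 hgeom
  simpa using tendsto_atTop_add_const_right atTop 1 this

end IsRescaledSequence

/-! ### The reference sequence h(q^n R) -/

/-- The rescaled coefficients of the solution of finite energy. -/
noncomputable def profileSeq (n : ℕ) : ℝ := profile (betaSq ^ n * dyadicRadius)

theorem betaSq_pow_mul_mem (n : ℕ) : betaSq ^ n * dyadicRadius ∈ Ioc 0 dyadicRadius :=
  ⟨mul_pos (pow_pos betaSq_pos n) dyadicRadius_pos, mul_le_of_le_one_left dyadicRadius_pos.le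
    (pow_le_one₀ betaSq_pos.le betaSq_lt_one.le)⟩

theorem profileSeq_eq (n : ℕ) :
    profileSeq n = profileNum (betaSq ^ n * dyadicRadius) / (betaSq ^ n * dyadicRadius) := rfl

theorem isRescaledSequence_profileSeq : IsRescaledSequence profileSeq where
  zero := by rw [profileSeq, pow_zero, one_mul, profile_dyadicRadius]
  pos_one := div_pos (profileNum_pos (betaSq_pow_mul_mem 1).1.le
    (mul_lt_of_lt_one_left dyadicRadius_pos (by rw [pow_one]; exact betaSq_lt_one)))
    (betaSq_pow_mul_mem 1).1
  recurrence n := by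
    have h := profile_mul_profile (betaSq_pow_mul_mem n)
    rw [← mul_assoc, ← mul_assoc, ← pow_succ', ← pow_add, add_comm 2] at h
    have hpos : 0 < profile (betaSq ^ (n + 1) * dyadicRadius) :=
      div_pos (profileNum_pos (betaSq_pow_mul_mem _).1.le (mul_lt_of_lt_one_left dyadicRadius_pos
        (pow_lt_one₀ betaSq_pos.le betaSq_lt_one (by omega)))) (betaSq_pow_mul_mem _).1
    rw [profileSeq, profileSeq, profileSeq, ← h, mul_div_cancel_left₀ _ hpos.ne', add_sub_cancel]

theorem tendsto_profileSeq : Tendsto profileSeq atTop atTop := by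
  have h1 : Tendsto (fun n => betaSq ^ n * dyadicRadius) atTop (𝓝[>] 0) := by
    refine tendsto_nhdsWithin_iff.2 ⟨?_, Eventually.of_forall fun n => (betaSq_pow_mul_mem n).1⟩
    simpa using (tendsto_pow_atTop_nhds_zero_of_lt_one betaSq_pos.le betaSq_lt_one).mul_const
      dyadicRadius
  exact tendsto_profileNum.pos_mul_atTop one_pos h1.inv_tendsto_nhdsGT_zero

/-- The quotient tends to 1/q < 1.6; the slack up to 2 is covered by g(q^n R) ≥ 0.8. -/
theorem eventually_profileSeq_succ_le :
    ∀ᶠ n in atTop, profileSeq (n + 1) ≤ 2 * profileSeq n := by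
  filter_upwards [tendsto_profileNum.eventually_const_le (u := 0.8) (by norm_num)] with n hn
  have h1 := betaSq_pow_mul_mem n
  have h2 := profileNum_le_one (betaSq_pow_mul_mem (n + 1)).1.le
  have hq := betaSq_pos
  rw [profileSeq_eq, profileSeq_eq, pow_succ, mul_right_comm] at *
  have h3 := h1.1
  rw [← mul_div_assoc, div_le_div_iff₀ (mul_pos h3 hq) h3]
  have h4 : 1 ≤ 2 * profileNum (betaSq ^ n * dyadicRadius) * betaSq := by nlinarith [lt_betaSq]
  nlinarith

/-! ### Coefficient sequences -/

/-- Rescaling removes both the powers of two and n₀, so one reference sequence serves every n₀. -/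
theorem IsCoefficientSequence.isRescaledSequence {n₀ : ℕ} {a : ℕ → ℝ}
    (ha : IsCoefficientSequence n₀ a) : IsRescaledSequence (rescaled n₀ a) where
  zero := by rw [rescaled, zero_add, ha.eq_zero n₀ le_rfl, mul_zero]
  pos_one := by
    have := ha.pos
    rw [rescaled, add_comm 1]
    positivity
  recurrence n := by
    have h := ha.recurrence (n + 1 + n₀) (by omega)
    rw [show n + 1 + n₀ + 1 = n + 2 + n₀ by ring, show n + 1 + n₀ - 1 = n + n₀ by omega] at h
    rw [rescaled, rescaled, rescaled, h]
    have e1 : (2 : ℝ) ^ (n + 2 + n₀) = 4 * 2 ^ (n + n₀) := by ring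
    have e2 : (2 : ℝ) ^ (n + 1 + n₀) = 2 * 2 ^ (n + n₀) := by ring
    rw [e1, e2]
    have hp : (2 : ℝ) ^ (n + n₀) ≠ 0 := by positivity
    -- Positivity of a is deduced from this lemma, so it is not available yet; if the denominator
    -- vanishes, both quotients take the default value 0.
    rcases eq_or_ne (a (n + 1 + n₀)) 0 with h0 | h0
    · rw [h0]
      simp only [mul_zero, div_zero, add_zero]
      field_simp
      norm_num
    · field_simp
      ring

theorem IsCoefficientSequence.pos_of_lt {n₀ : ℕ} {a : ℕ → ℝ} (ha : IsCoefficientSequence n₀ a)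
    {n : ℕ} (hn : n₀ < n) : 0 < a n := by
  have h := ha.isRescaledSequence.pos (n - n₀ - 1)
  rw [rescaled, show n - n₀ - 1 + 1 + n₀ = n by omega] at h
  exact pos_of_mul_pos_right h (by positivity)

theorem IsCoefficientSequence.nonneg {n₀ : ℕ} {a : ℕ → ℝ} (ha : IsCoefficientSequence n₀ a)
    (n : ℕ) : 0 ≤ a n := by
  rcases lt_or_ge n₀ n with h | h
  · exact (ha.pos_of_lt h).le
  · exact (ha.eq_zero n h).ge

theorem IsCoefficientSequence.eq_of_rescaled_eq {n₀ : ℕ} {a : ℕ → ℝ}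
    (ha : IsCoefficientSequence n₀ a) (h : rescaled n₀ a 1 = profileSeq 1) {n : ℕ} (hn : n₀ ≤ n) :
    a n = (2 ^ n)⁻¹ * profileSeq (n - n₀) := by
  have := congrFun (ha.isRescaledSequence.unique isRescaledSequence_profileSeq h) (n - n₀)
  rw [← this, rescaled, Nat.sub_add_cancel hn]
  field_simp

/-- The coefficients of the self-similar solution of finite energy. -/
noncomputable def finiteEnergyCoeff (n₀ n : ℕ) : ℝ :=
  if n < n₀ then 0 else (2 ^ n)⁻¹ * profileSeq (n - n₀)

theorem finiteEnergyCoeff_of_le {n₀ n : ℕ} (h : n₀ ≤ n) :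
    finiteEnergyCoeff n₀ n = (2 ^ n)⁻¹ * profileSeq (n - n₀) := if_neg (by omega)

theorem isCoefficientSequence_finiteEnergyCoeff (n₀ : ℕ) :
    IsCoefficientSequence n₀ (finiteEnergyCoeff n₀) where
  eq_zero n hn := by
    rcases hn.lt_or_eq with h | rfl
    · exact if_pos h
    · rw [finiteEnergyCoeff_of_le le_rfl, Nat.sub_self, isRescaledSequence_profileSeq.zero,
        mul_zero]
  pos := by
    rw [finiteEnergyCoeff_of_le (by omega), Nat.add_sub_cancel_left]
    have := isRescaledSequence_profileSeq.pos_one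
    positivity
  recurrence n hn := by
    obtain ⟨k, rfl⟩ := Nat.exists_eq_add_of_le hn
    have hpos := isRescaledSequence_profileSeq.pos k
    rw [finiteEnergyCoeff_of_le (by omega), finiteEnergyCoeff_of_le (by omega),
      finiteEnergyCoeff_of_le (by omega), show n₀ + 1 + k + 1 - n₀ = k + 2 by omega,
      show n₀ + 1 + k - 1 - n₀ = k by omega, show n₀ + 1 + k - n₀ = k + 1 by omega,
      show n₀ + 1 + k - 1 = n₀ + k by omega, isRescaledSequence_profileSeq.recurrence]
    field_simp
    ring

theorem rescaled_finiteEnergyCoeff (n₀ : ℕ) :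
    rescaled n₀ (finiteEnergyCoeff n₀) 1 = profileSeq 1 := by
  rw [rescaled, finiteEnergyCoeff_of_le (by omega), Nat.add_sub_cancel]
  field_simp

theorem IsCoefficientSequence.ext_of_rescaled_eq {n₀ : ℕ} {a : ℕ → ℝ}
    (ha : IsCoefficientSequence n₀ a) (h : rescaled n₀ a 1 = profileSeq 1) :
    a = finiteEnergyCoeff n₀ := by
  funext n
  rcases lt_or_ge n n₀ with hn | hn
  · rw [ha.eq_zero n hn.le, finiteEnergyCoeff, if_pos hn]
  · rw [ha.eq_of_rescaled_eq h hn, finiteEnergyCoeff_of_le hn]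

theorem squareSummable_finiteEnergyCoeff (n₀ : ℕ) : SquareSummable (finiteEnergyCoeff n₀) := by
  refine (summable_nat_add_iff n₀).1 ?_
  have hR := dyadicRadius_pos
  have hq := betaSq_pos
  have hgeom : Summable fun n : ℕ => (dyadicRadius⁻¹) ^ 2 * (((2 * betaSq) ^ 2)⁻¹) ^ n := by
    refine (summable_geometric_of_lt_one (by positivity) (inv_lt_one_of_one_lt₀ ?_)).mul_left _
    -- The ratio is (2q)⁻², and 2q > 1.
    nlinarith [lt_betaSq]
  refine hgeom.of_nonneg_of_le (fun n => sq_nonneg _) fun n => ?_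
  have hmem := (betaSq_pow_mul_mem n)
  have hnum : 0 ≤ profileSeq n := profile_nonneg hmem
  have hle : profileSeq n ≤ (betaSq ^ n * dyadicRadius)⁻¹ := by
    rw [profileSeq_eq, div_eq_mul_inv]
    exact mul_le_of_le_one_left (inv_pos.2 hmem.1).le (profileNum_le_one hmem.1.le)
  have h2 : ((2 : ℝ) ^ (n + n₀))⁻¹ ≤ (2 ^ n)⁻¹ :=
    inv_anti₀ (by positivity) (pow_le_pow_right₀ one_le_two (by omega))
  rw [finiteEnergyCoeff_of_le (by omega), Nat.add_sub_cancel]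
  calc ((2 ^ (n + n₀))⁻¹ * profileSeq n) ^ 2
      ≤ ((2 ^ n)⁻¹ * (betaSq ^ n * dyadicRadius)⁻¹) ^ 2 := by gcongr
    _ = _ := by
      simp only [mul_pow, inv_pow, mul_inv, ← pow_mul, mul_comm 2 n]
      ring

/-! ### Super-exponential divergence -/

theorem tendsto_div_pow_of_eventually_mul_le {a : ℕ → ℝ} (hpos : ∀ j, 0 < a j)
    (h : ∀ K : ℝ, ∀ᶠ j in atTop, K * a j ≤ a (j + 1)) {M : ℝ} (hM : 0 < M) :
    Tendsto (fun j => a j / M ^ j) atTop atTop := by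
  obtain ⟨J, hJ⟩ := eventually_atTop.1 (h (2 * M))
  refine (tendsto_add_atTop_iff_nat J).1
    (tendsto_atTop_of_geom_le (c := 2) (div_pos (hpos _) (pow_pos hM _)) one_lt_two fun j => ?_)
  rw [← mul_div_assoc, div_le_div_iff₀ (pow_pos hM _) (pow_pos hM _)]
  have h1 := hJ (j + J) (by omega)
  have h2 := pow_pos hM (j + J)
  rw [show j + 1 + J = j + J + 1 by ring, pow_succ]
  nlinarith

theorem divergesSuperExponentially_of_eventually {a : ℕ → ℝ} (L : ℕ)
    (hpos : ∀ j, 0 < a (L + 2 * j))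
    (h : ∀ K : ℝ, ∀ᶠ j in atTop, K * a (L + 2 * j) ≤ a (L + 2 * (j + 1))) :
    DivergesSuperExponentially a := by
  refine ⟨L % 2, by omega, fun M hM => ?_⟩
  refine (tendsto_add_atTop_iff_nat (L / 2)).1 ?_
  have h1 := (tendsto_div_pow_of_eventually_mul_le hpos h hM).atTop_div_const
    (pow_pos hM (L / 2))
  refine h1.congr fun j => ?_
  rw [div_div, ← pow_add, show 2 * (j + L / 2) + L % 2 = L + 2 * j by omega]

theorem IsCoefficientSequence.divergesSuperExponentially {n₀ : ℕ} {a : ℕ → ℝ}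
    (ha : IsCoefficientSequence n₀ a) (h : rescaled n₀ a 1 ≠ profileSeq 1) :
    DivergesSuperExponentially a := by
  have hb := ha.isRescaledSequence
  have hs := isRescaledSequence_profileSeq
  obtain ⟨N, h1, h2⟩ := hb.exists_alternation hs h
  have halt := hb.alternation hs h1 h2
  have hlim := hb.tendsto_ratio hs tendsto_profileSeq h1 h2
  refine divergesSuperExponentially_of_eventually (N + 1 + n₀)
    (fun j => ha.pos_of_lt (by omega)) fun K => ?_
  obtain ⟨J, hJ⟩ := eventually_atTop.1 eventually_profileSeq_succ_le
  filter_upwards [hlim.eventually_ge_atTop (2 * K), eventually_ge_atTop J] with j hj hjJ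
  have h3 := hJ (N + 2 * j + 1) (by omega)
  have h4 := (halt j).2
  have hrec := hb.recurrence (N + 2 * j + 1)
  have p1 := hb.pos (N + 2 * j)
  have p2 := hb.pos (N + 2 * j + 1)
  have p3 := hs.pos (N + 2 * j)
  rw [le_div_iff₀ p3] at hj
  have h5 : 4 * (K * rescaled n₀ a (N + 2 * j + 1)) ≤ rescaled n₀ a (N + 2 * j + 1 + 2) := by
    rw [hrec]
    -- At the next index b ≤ s, and s at most doubles; so a present ratio b/s ≥ 2K yields the bound.
    -- The factor 4 of the recurrence then cancels the one lost in undoing the rescaling.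
    have h6 : K * rescaled n₀ a (N + 2 * j + 1 + 1) ≤ rescaled n₀ a (N + 2 * j + 1) := by
      rcases le_or_gt K 0 with hK | hK
      · exact (mul_nonpos_of_nonpos_of_nonneg hK p2.le).trans p1.le
      · nlinarith
    have h7 : 4 * (K * rescaled n₀ a (N + 2 * j + 1)) ≤
        4 * rescaled n₀ a (N + 2 * j + 1) ^ 2 / rescaled n₀ a (N + 2 * j + 1 + 1) := by
      rw [le_div_iff₀ p2]
      nlinarith
    linarith
  have e1 : N + 1 + n₀ + 2 * j = N + 2 * j + 1 + n₀ := by ring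
  have e2 : N + 1 + n₀ + 2 * (j + 1) = N + 2 * j + 1 + 2 + n₀ := by ring
  have e3 : (2 : ℝ) ^ (N + 2 * j + 1 + 2 + n₀) = 4 * 2 ^ (N + 2 * j + 1 + n₀) := by ring
  rw [e1, e2]
  rw [rescaled, rescaled, e3] at h5
  have h8 : (0 : ℝ) < 4 * 2 ^ (N + 2 * j + 1 + n₀) := by positivity
  refine le_of_mul_le_mul_left ?_ h8
  linarith

theorem DivergesSuperExponentially.not_squareSummable {a : ℕ → ℝ}
    (h : DivergesSuperExponentially a) : ¬ SquareSummable a := by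
  intro hs
  obtain ⟨p, _, hp⟩ := h
  have h1 := hp 1 one_pos
  simp only [one_pow, div_one] at h1
  have hidx : Tendsto (fun k : ℕ => 2 * k + p) atTop atTop :=
    tendsto_atTop_mono (fun k => by dsimp only [id]; omega) tendsto_id
  exact not_tendsto_nhds_of_tendsto_atTop ((tendsto_pow_atTop two_ne_zero).comp h1) 0
    (hs.tendsto_atTop_zero.comp hidx)

theorem DivergesSuperExponentially.convergenceRadius_eq_zero {a : ℕ → ℝ}
    (h : DivergesSuperExponentially a) : convergenceRadius a = 0 := by
  by_contra hne
  obtain ⟨r, hr0, hr⟩ := ENNReal.lt_iff_exists_nnreal_btwn.1 (pos_iff_ne_zero.2 hne)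
  have hr0' : (0 : ℝ) < r := by exact_mod_cast hr0
  have hs := FormalMultilinearSeries.summable_norm_mul_pow _ hr
  simp only [FormalMultilinearSeries.ofScalars_norm] at hs
  obtain ⟨p, _, hp⟩ := h
  have hidx : Tendsto (fun k : ℕ => 2 * k + p) atTop atTop :=
    tendsto_atTop_mono (fun k => by dsimp only [id]; omega) tendsto_id
  have h1 := (hp (((r : ℝ) ^ 2)⁻¹) (by positivity)).atTop_mul_const (pow_pos hr0' p)
  refine not_tendsto_nhds_of_tendsto_atTop (tendsto_atTop_mono (fun k => ?_) h1) 0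
    (hs.tendsto_atTop_zero.comp hidx)
  rw [inv_pow, div_inv_eq_mul, mul_assoc, ← pow_mul, ← pow_add]
  exact mul_le_mul_of_nonneg_right (le_abs_self _) (by positivity)

theorem IsCoefficientSequence.squareSummable_iff {n₀ : ℕ} {a : ℕ → ℝ}
    (ha : IsCoefficientSequence n₀ a) : SquareSummable a ↔ rescaled n₀ a 1 = profileSeq 1 := by
  constructor
  · intro hs
    by_contra hne
    exact (ha.divergesSuperExponentially hne).not_squareSummable hs
  · intro h
    rw [ha.ext_of_rescaled_eq h]
    exact squareSummable_finiteEnergyCoeff n₀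

/-! ### Asymptotics of the finite energy coefficients -/

theorem two_pow_inv_eq_beta_pow (n : ℕ) : ((2 : ℝ) ^ n)⁻¹ = beta ^ (3 * n) := by
  rw [pow_mul, beta_pow_three, inv_pow]

theorem finiteEnergyCoeff_eq_mul {n₀ n : ℕ} (h : n₀ ≤ n) :
    finiteEnergyCoeff n₀ n = profileNum (betaSq ^ (n - n₀) * dyadicRadius) *
      (beta ^ (2 * n₀) / dyadicRadius * beta ^ n) := by
  obtain ⟨k, rfl⟩ := Nat.exists_eq_add_of_le h
  have hb := beta_pos.ne'
  have hR := dyadicRadius_pos.ne'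
  rw [finiteEnergyCoeff_of_le h, Nat.add_sub_cancel_left, profileSeq_eq, two_pow_inv_eq_beta_pow,
    betaSq]
  field_simp
  ring

theorem finiteEnergyCoeff_isEquivalent (n₀ : ℕ) :
    finiteEnergyCoeff n₀ ~[atTop] fun n => beta ^ (2 * n₀) / dyadicRadius * beta ^ n :=
  isEquivalent_iff_exists_eq_mul.2 ⟨fun n => profileNum (betaSq ^ (n - n₀) * dyadicRadius),
    tendsto_profileNum.comp (tendsto_sub_atTop_nat n₀),
    (eventually_ge_atTop n₀).mono fun _ hn => finiteEnergyCoeff_eq_mul hn⟩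

theorem waveNumber_rpow (n : ℕ) : waveNumber n ^ (-(1 / 3) : ℝ) = beta ^ n := by
  rw [waveNumber, beta, Real.rpow_pow_comm two_pos.le]

theorem tendsto_finiteEnergyCoeff_div (n₀ : ℕ) :
    Tendsto (fun n => finiteEnergyCoeff n₀ n / waveNumber n ^ (-(1 / 3) : ℝ)) atTop
      (𝓝 (beta ^ (2 * n₀) / dyadicRadius)) := by
  have h := (tendsto_profileNum.comp (tendsto_sub_atTop_nat n₀)).mul_const
    (beta ^ (2 * n₀) / dyadicRadius)
  rw [one_mul] at h
  refine h.congr' ((eventually_ge_atTop n₀).mono fun n hn => ?_)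
  have hb := beta_pos.ne'
  simp only [Function.comp_apply]
  rw [waveNumber_rpow, finiteEnergyCoeff_eq_mul hn]
  field_simp

/-! ### Self-similar solutions -/

/-- The algebraic equations for the coefficients of a self-similar solution. -/
def IsSelfSimilarCoefficients (a : ℕ → ℝ) : Prop :=
  a 0 = 0 ∧ ∀ n, -a (n + 1) = 2 ^ n * a n ^ 2 - 2 ^ (n + 1) * a (n + 1) * a (n + 2)

theorem hasDerivAt_selfSimilar (a : ℕ → ℝ) (n : ℕ) {t₀ t : ℝ} (ht : t ≠ t₀) :
    HasDerivAt (selfSimilar t₀ a n) (-a n / (t - t₀) ^ 2) t := by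
  have h : HasDerivAt (selfSimilar t₀ a n) _ t :=
    (hasDerivAt_const t (a n)).div ((hasDerivAt_id t).sub_const t₀) (sub_ne_zero.2 ht)
  simpa using h

theorem IsSelfSimilarCoefficients.isComponentwiseSolutionOn {a : ℕ → ℝ}
    (ha : IsSelfSimilarCoefficients a) {t₀ : ℝ} {I : Set ℝ} (hI : ∀ t ∈ I, t₀ < t) :
    IsComponentwiseSolutionOn I (selfSimilar t₀ a) where
  zero t _ := by rw [selfSimilar, ha.1, zero_div]
  contDiffOn n := contDiffOn_const.div (contDiffOn_id.sub contDiffOn_const)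
    fun t ht => (sub_pos.2 (hI t ht)).ne'
  equation n hn t ht := by
    obtain ⟨m, rfl⟩ := Nat.exists_eq_add_of_le' hn
    have h0 := (sub_pos.2 (hI t ht)).ne'
    have hval : waveNumber (m + 1 - 1) * selfSimilar t₀ a (m + 1 - 1) t ^ 2 -
        waveNumber (m + 1) * selfSimilar t₀ a (m + 1) t * selfSimilar t₀ a (m + 1 + 1) t =
          -a (m + 1) / (t - t₀) ^ 2 := by
      rw [ha.2 m, Nat.add_sub_cancel]
      simp only [selfSimilar, waveNumber]
      field_simp
    rw [hval]
    exact (hasDerivAt_selfSimilar a (m + 1) (hI t ht).ne').hasDerivWithinAt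

/-- Both sides of each equation are multiples of (t - t₀)⁻², so the single time t = 0 suffices,
where the one-sided derivative is unique. -/
theorem isSelfSimilarCoefficients_of_isComponentwiseSolutionOn {a : ℕ → ℝ} {t₀ : ℝ} (ht₀ : t₀ < 0)
    (h : IsComponentwiseSolutionOn (Ici 0) (selfSimilar t₀ a)) : IsSelfSimilarCoefficients a := by
  have ht : (0 : ℝ) - t₀ ≠ 0 := by linarith
  refine ⟨?_, fun n => ?_⟩
  · have := h.zero 0 self_mem_Ici
    rw [selfSimilar, div_eq_zero_iff] at this
    exact this.resolve_right ht
  · have h1 := h.equation (n + 1) (by omega) 0 self_mem_Ici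
    have h2 := (hasDerivAt_selfSimilar a (n + 1) ht₀.ne').hasDerivWithinAt (s := Ici 0)
    have h3 := (uniqueDiffOn_Ici (0 : ℝ) 0 self_mem_Ici).eq_deriv _ h2 h1
    rw [Nat.add_sub_cancel] at h3
    simp only [selfSimilar, waveNumber] at h3
    field_simp at h3
    linarith

/-- The equation can be solved for a_{n+2} only where a_{n+1} ≠ 0. Non-negativity makes the first
non-zero coefficient positive, and the solved form passes positivity on. -/
theorem isCoefficientSequence_iff {n₀ : ℕ} {a : ℕ → ℝ} :
    IsCoefficientSequence n₀ a ↔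
      IsSelfSimilarCoefficients a ∧ (∀ n, 0 ≤ a n) ∧ StartsAfter n₀ a := by
  constructor
  · intro ha
    refine ⟨⟨ha.eq_zero 0 (by omega), fun n => ?_⟩, ha.nonneg, fun n _ hn => ha.eq_zero n hn,
      ha.pos.ne'⟩
    rcases lt_or_ge n n₀ with hn | hn
    · rw [ha.eq_zero n hn.le, ha.eq_zero (n + 1) hn]
      simp
    · have hr := ha.recurrence (n + 1) (by omega)
      have hpos := ha.pos_of_lt (n := n + 1) (by omega)
      rw [Nat.add_sub_cancel] at hr
      rw [hr, pow_succ]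
      field_simp
      ring
  · rintro ⟨⟨h0, heq⟩, hnn, hz, hne⟩
    have hpos1 : 0 < a (n₀ + 1) := lt_of_le_of_ne (hnn _) hne.symm
    have hrec : ∀ n, 0 < a (n + 1) → a (n + 2) = (2 ^ (n + 1))⁻¹ + a n ^ 2 / (2 * a (n + 1)) := by
      intro n hn
      have h1 := heq n
      rw [pow_succ (2 : ℝ) n] at h1 ⊢
      field_simp
      linarith
    have hpos : ∀ k, 0 < a (n₀ + k + 1) := by
      intro k
      induction k with
      | zero => exact hpos1
      | succ k ih =>
        have := hrec _ ih
        rw [show n₀ + (k + 1) + 1 = n₀ + k + 2 by ring, this]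
        positivity
    refine ⟨fun n hn => ?_, hpos1, fun n hn => ?_⟩
    · rcases Nat.eq_zero_or_pos n with rfl | h
      · exact h0
      · exact hz n h hn
    · obtain ⟨k, rfl⟩ := Nat.exists_eq_add_of_le hn
      have := hrec (n₀ + k) (hpos k)
      rw [show n₀ + 1 + k + 1 = n₀ + k + 2 by ring, show n₀ + 1 + k - 1 = n₀ + k by omega,
        show n₀ + 1 + k = n₀ + k + 1 by ring]
      exact this

theorem isPositiveSolution_selfSimilar_iff {t₀ : ℝ} (ht₀ : t₀ < 0) {n₀ : ℕ} {a : ℕ → ℝ} :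
    (IsPositiveSolution (selfSimilar t₀ a) ∧ StartsAfter n₀ a) ↔ IsCoefficientSequence n₀ a := by
  rw [isCoefficientSequence_iff]
  constructor
  · rintro ⟨⟨h1, h2⟩, h3⟩
    refine ⟨isSelfSimilarCoefficients_of_isComponentwiseSolutionOn ht₀ h1, fun n => ?_, h3⟩
    have h4 : 0 ≤ a n / (0 - t₀) := h2 0 le_rfl n
    have := mul_nonneg h4 (show 0 ≤ 0 - t₀ by linarith)
    rwa [div_mul_cancel₀ _ (by linarith)] at this
  · rintro ⟨h1, h2, h3⟩
    exact ⟨⟨h1.isComponentwiseSolutionOn fun t ht => ht₀.trans_le ht, fun t ht n =>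
      div_nonneg (h2 n) (by linarith)⟩, h3⟩

theorem hasFiniteEnergy_selfSimilar_iff {t₀ : ℝ} (ht₀ : t₀ < 0) {a : ℕ → ℝ} :
    HasFiniteEnergy (selfSimilar t₀ a) ↔ SquareSummable a := by
  constructor
  · intro h
    refine ((h 0 le_rfl).mul_right ((0 - t₀) ^ 2)).congr fun n => ?_
    have : (0 : ℝ) - t₀ ≠ 0 := by linarith
    simp only [selfSimilar]
    field_simp
  · intro h t _
    refine (h.mul_right (((t - t₀) ^ 2)⁻¹)).congr fun n => ?_
    simp only [selfSimilar]
    rw [div_pow, div_eq_mul_inv]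

theorem profileSeq_eq_profile_beta (n : ℕ) :
    profileSeq n = profile (beta ^ (2 * n) * dyadicRadius) := by
  rw [profileSeq, betaSq, pow_mul]

theorem mainTheorem1 :
    ∃ (d : ℤ → ℝ) (R : ℝ) (h : ℝ → ℝ) (γ : ℝ),
      -- the coefficients `d_k`, the radius `R` and the function `h`
      (IsSeriesCoefficients d ∧ (∀ d', IsSeriesCoefficients d' → d' = d) ∧
        (∀ k : ℤ, 0 ≤ k → 0 ≤ d k)) ∧
      (R ∈ Ioo (4 / 5 : ℝ) 1 ∧
        convergenceRadius (fun k : ℕ => d k) = ENNReal.ofReal R) ∧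
      ((∀ x ∈ Ioo 0 R, HasSum (fun k : ℕ => d k * x ^ k) (x⁻¹ - h x)) ∧
        StrictAntiOn h (Ioc 0 R) ∧ BijOn h (Ioc 0 R) (Ici 0)) ∧
      γ = h (beta ^ 2 * R) ∧
      -- existence and uniqueness of the finite energy positive self-similar solutions
      (∀ t₀ : ℝ, t₀ < 0 → ∀ n₀ : ℕ,
        (∃! a : ℕ → ℝ, IsPositiveSolution (selfSimilar t₀ a) ∧
          HasFiniteEnergy (selfSimilar t₀ a) ∧ StartsAfter n₀ a) ∧
        ∀ a : ℕ → ℝ, IsPositiveSolution (selfSimilar t₀ a) →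
          HasFiniteEnergy (selfSimilar t₀ a) → StartsAfter n₀ a →
          IsComponentwiseSolutionOn (Ioi t₀) (selfSimilar t₀ a) ∧
          (∀ n, n₀ < n → a n = (2 ^ n)⁻¹ * h (beta ^ (2 * (n - n₀)) * R)) ∧
          Tendsto (fun n => a n / waveNumber n ^ (-(1 / 3) : ℝ)) atTop
            (𝓝 (beta ^ (2 * n₀) / R))) ∧
      -- all positive self-similar solutions, of finite energy or not
      (∀ t₀ : ℝ, t₀ < 0 → ∀ (n₀ : ℕ) (a : ℕ → ℝ),
        (IsPositiveSolution (selfSimilar t₀ a) ∧ StartsAfter n₀ a) ↔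
          IsCoefficientSequence n₀ a) ∧
      -- square summability singles out exactly one value of `ã_1`
      (∀ (n₀ : ℕ) (γ' : ℝ),
        (∀ a, IsCoefficientSequence n₀ a → (SquareSummable a ↔ rescaled n₀ a 1 = γ')) ↔
          γ' = γ) ∧
      (∀ (n₀ : ℕ) (a : ℕ → ℝ), IsCoefficientSequence n₀ a → SquareSummable a →
        (∀ n, n₀ < n → a n = (2 ^ n)⁻¹ * h (beta ^ (2 * (n - n₀)) * R)) ∧
        a ~[atTop] fun n => beta ^ (2 * n₀) / R * beta ^ n) ∧
      (∀ (n₀ : ℕ) (a : ℕ → ℝ), IsCoefficientSequence n₀ a → ¬ SquareSummable a →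
        DivergesSuperExponentially a ∧ convergenceRadius a = 0) := by
  have hfin : ∀ n₀ n, n₀ < n → finiteEnergyCoeff n₀ n =
      (2 ^ n)⁻¹ * profile (beta ^ (2 * (n - n₀)) * dyadicRadius) := fun n₀ n hn => by
    rw [finiteEnergyCoeff_of_le hn.le, profileSeq_eq_profile_beta]
  have hγ : profileSeq 1 = profile (beta ^ 2 * dyadicRadius) := profileSeq_eq_profile_beta 1
  have heq : ∀ {t₀ : ℝ}, t₀ < 0 → ∀ {n₀ : ℕ} {a : ℕ → ℝ}, IsPositiveSolution (selfSimilar t₀ a) →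
      HasFiniteEnergy (selfSimilar t₀ a) → StartsAfter n₀ a → a = finiteEnergyCoeff n₀ := by
    intro t₀ ht₀ n₀ a h1 h2 h3
    have ha := (isPositiveSolution_selfSimilar_iff ht₀).1 ⟨h1, h3⟩
    exact ha.ext_of_rescaled_eq
      (ha.squareSummable_iff.1 ((hasFiniteEnergy_selfSimilar_iff ht₀).1 h2))
  refine ⟨seriesCoeff, dyadicRadius, profile, profile (beta ^ 2 * dyadicRadius),
    ⟨isSeriesCoefficients_seriesCoeff, fun d' hd' => hd'.unique isSeriesCoefficients_seriesCoeff,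
      fun k hk => ?_⟩,
    ⟨⟨lt_dyadicRadius, dyadicRadius_lt_one⟩, convergenceRadius_seriesCoeff⟩,
    ⟨fun x hx => hasSum_seriesCoeff ⟨hx.1, hx.2.le⟩, strictAntiOn_profile, bijOn_profile⟩, rfl,
    fun t₀ ht₀ n₀ => ⟨?_, fun a h1 h2 h3 => ?_⟩,
    fun t₀ ht₀ n₀ a => isPositiveSolution_selfSimilar_iff ht₀, fun n₀ γ' => ⟨fun h => ?_, ?_⟩,
    fun n₀ a ha hs => ?_, fun n₀ a ha hs => ?_⟩
  · lift k to ℕ using hk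
    rw [seriesCoeff_natCast]
    exact shiftedCoeff_nonneg _
  · have ha := (isPositiveSolution_selfSimilar_iff ht₀).2
      (isCoefficientSequence_finiteEnergyCoeff n₀)
    exact ⟨finiteEnergyCoeff n₀, ⟨ha.1, (hasFiniteEnergy_selfSimilar_iff ht₀).2
      (squareSummable_finiteEnergyCoeff n₀), ha.2⟩, fun a h => heq ht₀ h.1 h.2.1 h.2.2⟩
  · obtain rfl := heq ht₀ h1 h2 h3
    exact ⟨(isSelfSimilarCoefficients_of_isComponentwiseSolutionOn ht₀
      h1.1).isComponentwiseSolutionOn fun t ht => ht, hfin n₀, tendsto_finiteEnergyCoeff_div n₀⟩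
  -- The finite energy sequence is square summable with ã_1 = γ, so testing on it alone determines
  -- γ'.
  · rw [← hγ, ← rescaled_finiteEnergyCoeff n₀]
    exact ((h _ (isCoefficientSequence_finiteEnergyCoeff n₀)).1
      (squareSummable_finiteEnergyCoeff n₀)).symm
  · rintro rfl a ha
    rw [ha.squareSummable_iff, hγ]
  · obtain rfl := ha.ext_of_rescaled_eq (ha.squareSummable_iff.1 hs)
    exact ⟨hfin n₀, finiteEnergyCoeff_isEquivalent n₀⟩
  · have h := ha.divergesSuperExponentially fun h => hs (ha.squareSummable_iff.2 h)
    exact ⟨h, h.convergenceRadius_eq_zero⟩
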